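/- Let $d\ge 2$, let $\mathrm{SPD}$ be the set of symmetric positive-definite real $d\times d$ matrices, and let $\Omega=C(\mathbb R^d,\mathrm{SPD})$ with the $\sigma$-algebra generated by cylinder sets. For $g\in\Omega$ and a $C^1$ curve $\gamma:[a,b]\to\mathbb R^d$ put $R(\gamma)=\int_a^b\sqrt{\langle\dot\gamma(t),g(\gamma(t))\dot\gamma(t)\rangle}\,dt$, and let $d(x,y)=\inf_\gamma R(\gamma)$, the infimum being over all $C^1$ curves from $x$ to $y$. Let $\Lambda_0=\sup_{x\in[-1/2,1/2)^d}\Lambda(x)$, where $\Lambda(x)$ is the maximum eigenvalue of $g(x)$. Let $\mathbb P$ be a probability measure on $\Omega$, and let $g$ have distribution $\mathbb P$. Assume: 1. $\mathbb P$ is invariant under the translations $g\mapsto g(\cdot+y)$, $y\in\mathbb R^d$; 2. $\mathbb P$ has finite-range dependence: there is $R>0$ such that, whenever $A,B\subseteq\mathbb R^d$ satisfy $|x-y|\ge R$ for all $x\in A$, $y\in B$, the families $(g(x))_{x\in A}$ and $(g(y))_{y\in B}$ are independent; 3. $\mathbb E[e^{a\Lambda_0}]<\infty$ for some $a>0$ (in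 particular this holds if $\mathbb E[e^{r\Lambda_0}]<\infty$ for all $r\in\mathbb R$). Then for each unit vector $v\in S^{d-1}$ there is a non-random constant $\mu_v\ge 0$ such that $\tfrac1t d(0,tv)\to\mu_v$ as $t\to\infty$, almost surely and in $L^1$, and this convergence is uniform over the sphere: for every $\epsilon>0$, with probability one, there exists $T>0$ such that for all $t\ge T$ and all $v\in S^{d-1}$ simultaneously, $$\left|\tfrac1t d(0,tv)-\mu_v\right|\le\epsilon .$$ -/

import Mathlib

open MeasureTheory ProbabilityTheory Filter Set Topology

noncomputable section

namespace RiemannianFPP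

/-- Symmetric positive-definite real `d × d` matrices. -/
abbrev SPD (d : ℕ) : Type := {A : Matrix (Fin d) (Fin d) ℝ // A.PosDef}

/-- The Borel sigma-algebra of the topology inherited from the space of all matrices. -/
instance spdMeasurableSpace (d : ℕ) : MeasurableSpace (SPD d) := borel (SPD d)

instance spdBorelSpace (d : ℕ) : BorelSpace (SPD d) := ⟨rfl⟩

/-- Continuous Riemannian metrics on `ℝ^d`. -/
abbrev RMetric (d : ℕ) : Type := C(EuclideanSpace ℝ (Fin d), SPD d)

variable {d : ℕ}

/-- The sigma-algebra generated by the values `g x`, `x ∈ A`. -/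
@[reducible]
def sigmaOn (A : Set (EuclideanSpace ℝ (Fin d))) : MeasurableSpace (RMetric d) :=
  ⨆ x ∈ A, MeasurableSpace.comap (fun g : RMetric d => g x) (spdMeasurableSpace d)

/-- The sigma-algebra generated by cylinder sets. -/
instance cylinderSigma : MeasurableSpace (RMetric d) := sigmaOn Set.univ

/-- The translated metric `x ↦ g (x + y)`. -/
def shift (y : EuclideanSpace ℝ (Fin d)) (g : RMetric d) : RMetric d :=
  ⟨fun x => g (x + y), by fun_prop⟩

/-- The law `P` of a random metric is translation-invariant. -/
def TranslationInvariant (P : Measure (RMetric d)) : Prop :=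
  ∀ y : EuclideanSpace ℝ (Fin d), MeasurePreserving (shift y) P P

/-- Finite-range dependence: for some `R > 0`, the restrictions of the metric to any two sets at
Euclidean distance at least `R` from each other are independent. -/
def FiniteRangeDependence (P : Measure (RMetric d)) : Prop :=
  ∃ R : ℝ, 0 < R ∧ ∀ A B : Set (EuclideanSpace ℝ (Fin d)),
    (∀ x ∈ A, ∀ y ∈ B, R ≤ dist x y) → Indep (sigmaOn A) (sigmaOn B) P

/-- The maximum eigenvalue of a symmetric positive-definite matrix. -/
def maxEigenvalue (A : SPD d) : ℝ := ⨆ i : Fin d, A.2.isHermitian.eigenvalues i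

/-- `Λ(K)`, the supremum over `K` of the maximum eigenvalue of `g x`. -/
def bigLambda (g : RMetric d) (K : Set (EuclideanSpace ℝ (Fin d))) : ℝ :=
  sSup ((fun x => maxEigenvalue (g x)) '' K)

/-- The unit cube `[z - 1/2, z + 1/2)^d` centered at a lattice point `z`. -/
def unitCube (z : Fin d → ℤ) : Set (EuclideanSpace ℝ (Fin d)) :=
  {x | ∀ i, x i ∈ Ico ((z i : ℝ) - 1 / 2) ((z i : ℝ) + 1 / 2)}

/-- `Λ_0` has a finite exponential moment `E[exp (a Λ_0)]` for some `a > 0`. -/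
def FiniteExpMoment (P : Measure (RMetric d)) : Prop :=
  ∃ a : ℝ, 0 < a ∧ Integrable (fun g => Real.exp (a * bigLambda g (unitCube 0))) P

/-- The Riemannian length `√⟨v, g(x) v⟩` of a tangent vector `v` at `x`. -/
def tangentNorm (g : RMetric d) (x v : EuclideanSpace ℝ (Fin d)) : ℝ :=
  Real.sqrt (v.ofLp ⬝ᵥ ((g x).1.mulVec v.ofLp))

/-- The Riemannian length of a `C^1` curve `γ : [a, b] → ℝ^d`. -/
def riemLength (g : RMetric d) (a b : ℝ) (γ : ℝ → EuclideanSpace ℝ (Fin d)) : ℝ :=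
  ∫ t in a..b, tangentNorm g (γ t) (derivWithin γ (Icc a b) t)

/-- The Riemannian distance: the infimum of the lengths of the `C^1` curves from `x` to `y`. -/
def riemDist (g : RMetric d) (x y : EuclideanSpace ℝ (Fin d)) : ℝ :=
  sInf {r | ∃ (a b : ℝ) (γ : ℝ → EuclideanSpace ℝ (Fin d)), a < b ∧
    ContDiffOn ℝ 1 γ (Icc a b) ∧ γ a = x ∧ γ b = y ∧ r = riemLength g a b γ}

/-- `m` is the limit of `d(0, t v) / t` as `t → ∞`, both almost surely and in `L^1`. -/
def IsTimeConstant (P : Measure (RMetric d)) (v : EuclideanSpace ℝ (Fin d)) (m : ℝ) : Prop :=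
  (∀ᵐ g ∂P, Tendsto (fun t : ℝ => riemDist g 0 (t • v) / t) atTop (𝓝 m)) ∧
  (∀ t : ℝ, 0 < t → Integrable (fun g => riemDist g 0 (t • v)) P) ∧
  Tendsto (fun t : ℝ => ∫ g, |riemDist g 0 (t • v) / t - m| ∂P) atTop (𝓝 0)

end RiemannianFPP

end

/-! Triangle inequality and stationarity make `n ↦ d(0, nv)` a subadditive process over the shift by
`v`, and `timeConstant` is the infimum of its normalized means. Two estimates, both using finite
range, replace the subadditive ergodic theorem.

Upper bound (`exists_ae_eventually_riemDist_le`): fix `m` with `E d(0, mv)` near `m` times the time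
constant and dominate `d(0, mv)` by a variable `Y` that sees the metric only in a ball. Sufficiently
spaced translates of `Y` are pairwise independent, so the strong law on each residue class bounds
`d(0, nv)` along multiples of a fixed integer.

Lower bound (`measure_liminfLeSet_eq_zero`): the event `B` that the lower limit is at most `c < μ`
is mapped into itself by the shift. Cutting trajectories into blocks of small cost
(`exists_integral_le_of_subadditive`), at rate about `c` on `B` and about `μ` off it by the upper
bound, gives `μ ≤ μ + 2ε - (μ - c) P(B)`. Hence `P(B) = 0`, without any appeal to ergodicity.

Continuous times and uniformity in the direction come from `exists_ae_riemDist_le`: at large scales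
the distance is Lipschitz with a nonrandom constant. Sums of local suprema over rows of unit cubes
have exponential tails, by the exponential moment and finite range; a box contains polynomially many
rows, so Borel–Cantelli controls them all. Interpolation then passes from integers to real times,
and a finite net of directions covers the sphere.

Convergence in mean follows from the almost sure one and a second moment bound for the average speed
on a segment, uniform in its length. -/

namespace RiemannianFPP

/-! ### Pointwise bounds on the norm of tangent vectors. -/

section Pointwise

variable {d : ℕ}

/-- An upper bound for the speed `tangentNorm g x v / ‖v‖`, continuous in both arguments. -/
def speedBound (g : RMetric d) (x : EuclideanSpace ℝ (Fin d)) : ℝ := 1 + (g x).1.trace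

lemma trace_nonneg (A : SPD d) : 0 ≤ A.1.trace := A.2.posSemidef.trace_nonneg

lemma one_le_speedBound (g : RMetric d) (x : EuclideanSpace ℝ (Fin d)) : 1 ≤ speedBound g x := by
  have := trace_nonneg (g x)
  unfold speedBound; linarith

lemma speedBound_nonneg (g : RMetric d) (x : EuclideanSpace ℝ (Fin d)) : 0 ≤ speedBound g x :=
  zero_le_one.trans (one_le_speedBound g x)

lemma continuous_trace : Continuous fun A : SPD d => A.1.trace := by
  fun_prop

lemma continuous_speedBound (g : RMetric d) : Continuous (speedBound g) :=
  continuous_const.add (continuous_trace.comp g.continuous)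

-- Write the matrix as `Bᴴ B`: its trace is the sum of the squared entries of `B`, and
-- Cauchy–Schwarz applies to each row of `B`.
open scoped MatrixOrder Matrix.Norms.L2Operator in
lemma quadForm_le (A : SPD d) (v : EuclideanSpace ℝ (Fin d)) :
    v.ofLp ⬝ᵥ (A.1.mulVec v.ofLp) ≤ A.1.trace * ‖v‖ ^ 2 := by
  obtain ⟨B, hB⟩ := CStarAlgebra.nonneg_iff_eq_star_mul_self.1 A.2.posSemidef.nonneg
  rw [Matrix.star_eq_conjTranspose] at hB
  have h1 : v.ofLp ⬝ᵥ (A.1.mulVec v.ofLp) = ∑ i, (∑ j, B i j * v j) ^ 2 := by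
    rw [hB, ← Matrix.mulVec_mulVec, Matrix.dotProduct_mulVec, Matrix.vecMul_conjTranspose]
    simp [dotProduct, Matrix.mulVec, sq]
  have h2 : A.1.trace = ∑ i, ∑ j, B i j ^ 2 := by
    rw [hB, Matrix.trace, Finset.sum_comm]
    simp [Matrix.mul_apply, sq]
  rw [h1, h2, EuclideanSpace.norm_sq_eq, Finset.sum_mul]
  refine Finset.sum_le_sum fun i _ => ?_
  simpa using Finset.sum_mul_sq_le_sq_mul_sq Finset.univ (fun j => B i j) (fun j => v j)

lemma tangentNorm_nonneg (g : RMetric d) (x v : EuclideanSpace ℝ (Fin d)) :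
    0 ≤ tangentNorm g x v := Real.sqrt_nonneg _

lemma tangentNorm_le (g : RMetric d) (x v : EuclideanSpace ℝ (Fin d)) :
    tangentNorm g x v ≤ speedBound g x * ‖v‖ := by
  refine Real.sqrt_le_iff.2 ⟨mul_nonneg (speedBound_nonneg g x) (norm_nonneg v), ?_⟩
  refine (quadForm_le (g x) v).trans ?_
  rw [mul_pow]
  refine mul_le_mul_of_nonneg_right ?_ (sq_nonneg _)
  have := trace_nonneg (g x)
  unfold speedBound; nlinarith

lemma tangentNorm_smul (g : RMetric d) (x v : EuclideanSpace ℝ (Fin d)) {c : ℝ} (hc : 0 ≤ c) :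
    tangentNorm g x (c • v) = c * tangentNorm g x v := by
  unfold tangentNorm
  rw [← Real.sqrt_sq hc, ← Real.sqrt_mul (sq_nonneg _), Real.sqrt_sq hc]
  simp [Matrix.mulVec_smul, sq, mul_assoc]

lemma tangentNorm_neg (g : RMetric d) (x v : EuclideanSpace ℝ (Fin d)) :
    tangentNorm g x (-v) = tangentNorm g x v := by
  simp [tangentNorm, Matrix.mulVec_neg]

lemma continuous_tangentNorm_uncurry :
    Continuous fun p : RMetric d × EuclideanSpace ℝ (Fin d) × EuclideanSpace ℝ (Fin d) =>
      tangentNorm p.1 p.2.1 p.2.2 := by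
  have h : Continuous fun p : RMetric d × EuclideanSpace ℝ (Fin d) × EuclideanSpace ℝ (Fin d) =>
      (p.1 p.2.1).1 := by fun_prop
  unfold tangentNorm dotProduct Matrix.mulVec dotProduct
  refine Real.continuous_sqrt.comp (continuous_finsetSum _ fun i _ => ?_)
  refine Continuous.mul (by fun_prop) (continuous_finsetSum _ fun j _ => ?_)
  exact ((continuous_apply j).comp ((continuous_apply i).comp h)).mul (by fun_prop)

lemma continuous_tangentNorm_comp {X : Type*} [TopologicalSpace X] {G : X → RMetric d}
    {p v : X → EuclideanSpace ℝ (Fin d)} (hG : Continuous G) (hp : Continuous p)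
    (hv : Continuous v) : Continuous fun t => tangentNorm (G t) (p t) (v t) :=
  continuous_tangentNorm_uncurry.comp (hG.prodMk (hp.prodMk hv))

lemma trace_le_mul_maxEigenvalue (A : SPD d) : A.1.trace ≤ d * maxEigenvalue A := by
  rw [A.2.isHermitian.trace_eq_sum_eigenvalues]
  have : ∀ i ∈ Finset.univ, A.2.isHermitian.eigenvalues i ≤ maxEigenvalue A := fun i _ =>
    le_ciSup (Set.finite_range _).bddAbove i
  simpa using Finset.sum_le_card_nsmul _ _ _ this

lemma maxEigenvalue_le_trace (A : SPD d) : maxEigenvalue A ≤ A.1.trace := by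
  refine Real.iSup_le (fun i => ?_) (trace_nonneg A)
  rw [A.2.isHermitian.trace_eq_sum_eigenvalues]
  simpa using Finset.single_le_sum (f := fun i => A.2.isHermitian.eigenvalues i)
    (fun i _ => (A.2.eigenvalues_pos i).le) (Finset.mem_univ i)

@[simp] lemma shift_apply (y x : EuclideanSpace ℝ (Fin d)) (g : RMetric d) :
    shift y g x = g (x + y) := rfl

@[simp] lemma speedBound_shift (y x : EuclideanSpace ℝ (Fin d)) (g : RMetric d) :
    speedBound (shift y g) x = speedBound g (x + y) := rfl

end Pointwise

/-! ### Curves, lengths and the metric properties of the distance. -/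

section Length

variable {d : ℕ}

/-- The length of a curve, computed with the two-sided derivative. -/
lemma riemLength_eq_integral_deriv (g : RMetric d) {a b : ℝ} (hab : a ≤ b)
    (γ : ℝ → EuclideanSpace ℝ (Fin d)) :
    riemLength g a b γ = ∫ t in a..b, tangentNorm g (γ t) (deriv γ t) := by
  unfold riemLength
  rw [intervalIntegral.integral_of_le hab, intervalIntegral.integral_of_le hab,
    integral_Ioc_eq_integral_Ioo, integral_Ioc_eq_integral_Ioo]
  refine setIntegral_congr_fun measurableSet_Ioo fun t ht => ?_
  simp only [derivWithin_of_mem_nhds (Icc_mem_nhds ht.1 ht.2)]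

lemma riemLength_nonneg (g : RMetric d) {a b : ℝ} (hab : a ≤ b)
    (γ : ℝ → EuclideanSpace ℝ (Fin d)) : 0 ≤ riemLength g a b γ :=
  intervalIntegral.integral_nonneg hab fun _ _ => tangentNorm_nonneg _ _ _

/-- `C^1` curves on the line that rest at `x` up to time `0` and at `y` from time `1` on. -/
def restCurves (x y : EuclideanSpace ℝ (Fin d)) : Set (ℝ → EuclideanSpace ℝ (Fin d)) :=
  {γ | ContDiff ℝ 1 γ ∧ (∀ t ≤ 0, γ t = x) ∧ ∀ t, 1 ≤ t → γ t = y}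

/-- The length of a curve defined on the line, between times `0` and `1`. -/
noncomputable def curveLength (g : RMetric d) (γ : ℝ → EuclideanSpace ℝ (Fin d)) : ℝ :=
  ∫ t in (0 : ℝ)..1, tangentNorm g (γ t) (deriv γ t)

lemma curveLength_nonneg (g : RMetric d) (γ : ℝ → EuclideanSpace ℝ (Fin d)) :
    0 ≤ curveLength g γ :=
  intervalIntegral.integral_nonneg zero_le_one fun _ _ => tangentNorm_nonneg _ _ _

lemma riemDist_le_riemLength (g : RMetric d) {x y : EuclideanSpace ℝ (Fin d)} {a b : ℝ}
    (hab : a < b) {γ : ℝ → EuclideanSpace ℝ (Fin d)} (hγ : ContDiffOn ℝ 1 γ (Icc a b))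
    (ha : γ a = x) (hb : γ b = y) : riemDist g x y ≤ riemLength g a b γ := by
  refine csInf_le ⟨0, ?_⟩ ⟨a, b, γ, hab, hγ, ha, hb, rfl⟩
  rintro r ⟨a, b, γ, hab, -, -, -, rfl⟩
  exact riemLength_nonneg g hab.le γ

lemma riemDist_nonneg (g : RMetric d) (x y : EuclideanSpace ℝ (Fin d)) : 0 ≤ riemDist g x y := by
  refine Real.sInf_nonneg ?_
  rintro r ⟨a, b, γ, hab, -, -, -, rfl⟩
  exact riemLength_nonneg g hab.le γ

lemma riemDist_le_curveLength (g : RMetric d) {x y : EuclideanSpace ℝ (Fin d)}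
    {γ : ℝ → EuclideanSpace ℝ (Fin d)} (hγ : γ ∈ restCurves x y) :
    riemDist g x y ≤ curveLength g γ := by
  rw [curveLength, ← riemLength_eq_integral_deriv g zero_le_one]
  exact riemDist_le_riemLength g zero_lt_one hγ.1.contDiffOn (hγ.2.1 0 le_rfl) (hγ.2.2 1 le_rfl)

/-- Slowing down at both ends turns a `C^1` curve on `[a, b]` into a resting curve of the same
length. -/
lemma exists_restCurve_length_eq {x y : EuclideanSpace ℝ (Fin d)} {a b : ℝ}
    (hab : a < b) {γ : ℝ → EuclideanSpace ℝ (Fin d)} (hγ : ContDiffOn ℝ 1 γ (Icc a b))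
    (ha : γ a = x) (hb : γ b = y) :
    ∃ η ∈ restCurves x y, ∀ g : RMetric d, curveLength g η = riemLength g a b γ := by
  set σ : ℝ → ℝ := fun t => a + (b - a) * Real.smoothTransition t with hσ
  have hba : 0 < b - a := sub_pos.2 hab
  have hσd : ContDiff ℝ 1 σ :=
    contDiff_const.add (contDiff_const.mul (Real.smoothTransition.contDiff (n := 1)))
  have hσmem : ∀ t, σ t ∈ Icc a b := fun t => by
    have h0 := Real.smoothTransition.nonneg t
    have h1 := Real.smoothTransition.le_one t
    constructor <;> simp only [hσ] <;> nlinarith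
  have hσ0 : ∀ t ≤ 0, σ t = a := fun t ht => by
    simp [hσ, Real.smoothTransition.zero_of_nonpos ht]
  have hσ1 : ∀ t, 1 ≤ t → σ t = b := fun t ht => by
    simp [hσ, Real.smoothTransition.one_of_one_le ht]
  have hσmono : Monotone σ := fun s t hst => by
    simp only [hσ]
    have := Real.smoothTransition.monotone hst
    nlinarith
  have hσ' : ∀ t, 0 ≤ deriv σ t := fun t => hσmono.deriv_nonneg
  have hσder : ∀ t, HasDerivAt σ (deriv σ t) t := fun t =>
    (hσd.differentiable one_ne_zero t).hasDerivAt
  have hder : ∀ t, HasDerivAt (γ ∘ σ) (deriv σ t • derivWithin γ (Icc a b) (σ t)) t := fun t =>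
    ((hγ.differentiableOn one_ne_zero _ (hσmem t)).hasDerivWithinAt).scomp_hasDerivAt t
      (hσder t) hσmem
  refine ⟨γ ∘ σ, ⟨hγ.comp_contDiff hσd hσmem, fun t ht => by simp [hσ0 t ht, ha],
    fun t ht => by simp [hσ1 t ht, hb]⟩, fun g => ?_⟩
  have hcont : ContinuousOn (fun t => tangentNorm g (γ t) (derivWithin γ (Icc a b) t))
      (Icc a b) := by
    have h1 := hγ.continuousOn
    have h2 := hγ.continuousOn_derivWithin (uniqueDiffOn_Icc hab) le_rfl
    have := (continuous_tangentNorm_uncurry (d := d)).comp_continuousOn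
      ((continuousOn_const (c := g)).prodMk (h1.prodMk h2))
    exact this
  unfold curveLength riemLength
  have := intervalIntegral.integral_comp_mul_deriv'' (a := 0) (b := 1) (f := σ) (f' := deriv σ)
    (g := fun t => tangentNorm g (γ t) (derivWithin γ (Icc a b) t))
    hσd.continuous.continuousOn (fun t _ => (hσder t).hasDerivWithinAt)
    (hσd.continuous_deriv le_rfl).continuousOn
    (hcont.mono (by rintro _ ⟨t, -, rfl⟩; exact hσmem t))
  rw [hσ0 0 le_rfl, hσ1 1 le_rfl] at this
  rw [← this]
  refine intervalIntegral.integral_congr fun t _ => ?_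
  simp only [(hder t).deriv, tangentNorm_smul g _ _ (hσ' t), Function.comp_apply, mul_comm]

lemma segment_contDiff (x y : EuclideanSpace ℝ (Fin d)) :
    ContDiff ℝ 1 fun t : ℝ => x + t • (y - x) := by fun_prop

lemma restCurves_nonempty (x y : EuclideanSpace ℝ (Fin d)) : (restCurves x y).Nonempty := by
  obtain ⟨η, hη, -⟩ := exists_restCurve_length_eq (x := x) (y := y) zero_lt_one
    (segment_contDiff x y).contDiffOn (by simp) (by simp)
  exact ⟨η, hη⟩

/-- Resting curves are globally `C^1` and remain so when joined or reversed, which spares all later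
arguments one-sided derivatives and corners. -/
lemma riemDist_eq_iInf_curveLength (g : RMetric d) (x y : EuclideanSpace ℝ (Fin d)) :
    riemDist g x y = ⨅ γ : restCurves x y, curveLength g γ.1 := by
  have hbdd : BddBelow (range fun γ : restCurves x y => curveLength g γ.1) :=
    ⟨0, by rintro _ ⟨γ, rfl⟩; exact curveLength_nonneg g _⟩
  have : Nonempty (restCurves x y) := (restCurves_nonempty x y).to_subtype
  refine le_antisymm (le_ciInf fun γ => riemDist_le_curveLength g γ.2) ?_
  refine le_csInf ?_ ?_
  · exact ⟨_, 0, 1, _, zero_lt_one, (segment_contDiff x y).contDiffOn, by simp, by simp, rfl⟩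
  · rintro r ⟨a, b, γ, hab, hγ, ha, hb, rfl⟩
    obtain ⟨η, hη, hl⟩ := exists_restCurve_length_eq hab hγ ha hb
    rw [← hl g]
    exact ciInf_le hbdd ⟨η, hη⟩

lemma exists_curveLength_lt {g : RMetric d} {x y : EuclideanSpace ℝ (Fin d)} {r : ℝ}
    (h : riemDist g x y < r) : ∃ γ ∈ restCurves x y, curveLength g γ < r := by
  have : Nonempty (restCurves x y) := (restCurves_nonempty x y).to_subtype
  rw [riemDist_eq_iInf_curveLength] at h
  obtain ⟨γ, hγ⟩ := exists_lt_of_ciInf_lt h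
  exact ⟨γ.1, γ.2, hγ⟩

lemma riemDist_triangle (g : RMetric d) (x y z : EuclideanSpace ℝ (Fin d)) :
    riemDist g x z ≤ riemDist g x y + riemDist g y z := by
  refine le_of_forall_pos_le_add fun ε hε => ?_
  obtain ⟨γ, hγ, h1⟩ := exists_curveLength_lt (lt_add_of_pos_right (riemDist g x y) (half_pos hε))
  obtain ⟨η, hη, h2⟩ := exists_curveLength_lt (lt_add_of_pos_right (riemDist g y z) (half_pos hε))
  -- One formula for the concatenation: up to time 1 the bracket vanishes, afterwards `γ` equals
  -- `y`. As a sum of `C^1` curves it is `C^1` at the junction too.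
  set ζ : ℝ → EuclideanSpace ℝ (Fin d) := fun t => γ t + (η (t - 1) - y) with hζ
  have hζd : ContDiff ℝ 1 ζ :=
    hγ.1.add ((hη.1.comp (contDiff_id.sub contDiff_const)).sub contDiff_const)
  have hζ1 : EqOn ζ γ (Iic 1) := fun t ht => by
    simp [hζ, hη.2.1 (t - 1) (by simpa using ht)]
  have hζ2 : EqOn ζ (fun t => η (t - 1)) (Ici 1) := fun t ht => by
    simp [hζ, hγ.2.2 t ht]
  have hcont : Continuous fun t => tangentNorm g (ζ t) (deriv ζ t) :=
    continuous_tangentNorm_comp continuous_const hζd.continuous (hζd.continuous_deriv le_rfl)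
  have h0 : riemDist g x z ≤ riemLength g 0 2 ζ := by
    refine riemDist_le_riemLength g two_pos hζd.contDiffOn ?_ ?_
    · rw [hζ1 (by simp), hγ.2.1 0 le_rfl]
    · rw [hζ2 (by simp : (2 : ℝ) ∈ Ici 1)]
      exact hη.2.2 _ (by norm_num)
  have h3 : ∫ t in (0 : ℝ)..1, tangentNorm g (ζ t) (deriv ζ t) = curveLength g γ := by
    unfold curveLength
    rw [intervalIntegral.integral_of_le zero_le_one, intervalIntegral.integral_of_le zero_le_one,
      integral_Ioc_eq_integral_Ioo, integral_Ioc_eq_integral_Ioo]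
    refine setIntegral_congr_fun measurableSet_Ioo fun t ht => ?_
    simp only [(hζ1.eventuallyEq_of_mem (Iic_mem_nhds ht.2)).deriv_eq, hζ1 ht.2.le]
  have h4 : ∫ t in (1 : ℝ)..2, tangentNorm g (ζ t) (deriv ζ t) = curveLength g η := by
    have : curveLength g η
        = ∫ t in (1 : ℝ)..2, tangentNorm g (η (t - 1)) (deriv η (t - 1)) := by
      rw [intervalIntegral.integral_comp_sub_right
        (fun t => tangentNorm g (η t) (deriv η t)) 1]
      norm_num [curveLength]
    rw [this, intervalIntegral.integral_of_le one_le_two, intervalIntegral.integral_of_le one_le_two]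
    refine setIntegral_congr_fun measurableSet_Ioc fun t ht => ?_
    simp only [(hζ2.eventuallyEq_of_mem (Ici_mem_nhds ht.1)).deriv_eq,
      hζ2 (show t ∈ Ici 1 from ht.1.le), deriv_comp_sub_const]
  rw [riemLength_eq_integral_deriv g zero_le_two,
    ← intervalIntegral.integral_add_adjacent_intervals (hcont.intervalIntegrable 0 1)
      (hcont.intervalIntegrable 1 2), h3, h4] at h0
  linarith

lemma riemDist_le_swap (g : RMetric d) (x y : EuclideanSpace ℝ (Fin d)) :
    riemDist g y x ≤ riemDist g x y := by
  refine le_of_forall_pos_le_add fun ε hε => ?_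
  obtain ⟨γ, hγ, h1⟩ := exists_curveLength_lt (lt_add_of_pos_right (riemDist g x y) hε)
  refine (riemDist_le_curveLength g (γ := fun t => γ (1 - t))
    ⟨hγ.1.comp (contDiff_const.sub contDiff_id), fun t ht => hγ.2.2 _ (by linarith),
      fun t ht => hγ.2.1 _ (by linarith)⟩).trans (le_trans (le_of_eq ?_) h1.le)
  unfold curveLength
  simp only [deriv_comp_const_sub, tangentNorm_neg]
  rw [intervalIntegral.integral_comp_sub_left (fun t => tangentNorm g (γ t) (deriv γ t)) 1]
  norm_num

lemma riemDist_comm (g : RMetric d) (x y : EuclideanSpace ℝ (Fin d)) :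
    riemDist g x y = riemDist g y x :=
  le_antisymm (riemDist_le_swap g y x) (riemDist_le_swap g x y)

/-- The distance is at most the length of the straight segment. -/
lemma riemDist_le_integral_speedBound (g : RMetric d) (x y : EuclideanSpace ℝ (Fin d)) :
    riemDist g x y ≤ ‖y - x‖ * ∫ t in (0 : ℝ)..1, speedBound g (x + t • (y - x)) := by
  refine (riemDist_le_riemLength g zero_lt_one (segment_contDiff x y).contDiffOn
    (by simp) (by simp)).trans ?_
  have hder : ∀ t, deriv (fun t : ℝ => x + t • (y - x)) t = y - x := fun t => by
    simpa using (((hasDerivAt_id t).smul_const (y - x)).const_add x).deriv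
  have hc : Continuous fun t : ℝ => x + t • (y - x) := (segment_contDiff x y).continuous
  rw [riemLength_eq_integral_deriv g zero_le_one, ← intervalIntegral.integral_const_mul]
  refine intervalIntegral.integral_mono_on zero_le_one ?_ ?_ fun t _ => ?_
  · simp only [hder]
    exact (continuous_tangentNorm_comp continuous_const hc continuous_const).intervalIntegrable _ _
  · exact (((continuous_speedBound g).comp hc).const_mul _).intervalIntegrable _ _
  · simp only [hder]
    rw [mul_comm]
    exact tangentNorm_le g _ _

lemma riemDist_le_of_speedBound_le (g : RMetric d) {x y : EuclideanSpace ℝ (Fin d)} {K : ℝ}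
    (h : ∀ t ∈ Icc (0 : ℝ) 1, speedBound g (x + t • (y - x)) ≤ K) :
    riemDist g x y ≤ ‖y - x‖ * K := by
  refine (riemDist_le_integral_speedBound g x y).trans
    (mul_le_mul_of_nonneg_left ?_ (norm_nonneg _))
  have hc : Continuous fun t : ℝ => x + t • (y - x) := (segment_contDiff x y).continuous
  have := intervalIntegral.integral_mono_on (a := 0) (b := 1) zero_le_one
    (((continuous_speedBound g).comp hc).intervalIntegrable _ _)
    (continuous_const.intervalIntegrable (μ := volume) _ _) h
  simpa using this

lemma riemDist_self (g : RMetric d) (x : EuclideanSpace ℝ (Fin d)) : riemDist g x x = 0 :=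
  le_antisymm (by simpa using riemDist_le_integral_speedBound g x x) (riemDist_nonneg g x x)

lemma add_const_mem_restCurves {x y z : EuclideanSpace ℝ (Fin d)}
    {γ : ℝ → EuclideanSpace ℝ (Fin d)} (hγ : γ ∈ restCurves x y) :
    (fun t => γ t + z) ∈ restCurves (x + z) (y + z) :=
  ⟨hγ.1.add contDiff_const, fun t ht => by simp [hγ.2.1 t ht], fun t ht => by simp [hγ.2.2 t ht]⟩

lemma curveLength_shift (g : RMetric d) (z : EuclideanSpace ℝ (Fin d))
    (γ : ℝ → EuclideanSpace ℝ (Fin d)) :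
    curveLength (shift z g) γ = curveLength g (fun t => γ t + z) := by
  simp [curveLength, tangentNorm]

lemma riemDist_shift (g : RMetric d) (x y z : EuclideanSpace ℝ (Fin d)) :
    riemDist (shift z g) x y = riemDist g (x + z) (y + z) := by
  refine le_antisymm (le_of_forall_pos_le_add fun ε hε => ?_)
    (le_of_forall_pos_le_add fun ε hε => ?_)
  · obtain ⟨γ, hγ, h1⟩ :=
      exists_curveLength_lt (lt_add_of_pos_right (riemDist g (x + z) (y + z)) hε)
    have := add_const_mem_restCurves (z := -z) hγ
    simp only [add_neg_cancel_right] at this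
    refine (riemDist_le_curveLength _ this).trans ?_
    rw [curveLength_shift]
    simpa using h1.le
  · obtain ⟨γ, hγ, h1⟩ := exists_curveLength_lt (lt_add_of_pos_right (riemDist (shift z g) x y) hε)
    refine (riemDist_le_curveLength _ (add_const_mem_restCurves (z := z) hγ)).trans ?_
    rw [← curveLength_shift]
    exact h1.le

end Length

/-! ### Measurability of lengths and distances. -/

section Measurability

variable {d : ℕ}

lemma sigmaOn_mono {A B : Set (EuclideanSpace ℝ (Fin d))} (h : A ⊆ B) : sigmaOn A ≤ sigmaOn B :=
  biSup_mono fun _ hx => h hx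

lemma sigmaOn_le (A : Set (EuclideanSpace ℝ (Fin d))) :
    sigmaOn A ≤ (cylinderSigma : MeasurableSpace (RMetric d)) := sigmaOn_mono (subset_univ A)

lemma measurable_apply_sigmaOn {A : Set (EuclideanSpace ℝ (Fin d))} {x : EuclideanSpace ℝ (Fin d)}
    (hx : x ∈ A) : Measurable[sigmaOn A] fun g : RMetric d => g x :=
  measurable_iff_comap_le.2
    (le_iSup₂_of_le (f := fun x (_ : x ∈ A) => MeasurableSpace.comap
      (fun g : RMetric d => g x) (spdMeasurableSpace d)) x hx le_rfl)

lemma measurable_apply (x : EuclideanSpace ℝ (Fin d)) : Measurable fun g : RMetric d => g x :=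
  measurable_apply_sigmaOn (mem_univ x)

lemma measurable_shift_sigmaOn (y : EuclideanSpace ℝ (Fin d))
    (A : Set (EuclideanSpace ℝ (Fin d))) :
    Measurable[sigmaOn ((· + y) '' A), sigmaOn A] (shift y : RMetric d → RMetric d) := by
  rw [measurable_iff_comap_le, sigmaOn, MeasurableSpace.comap_iSup]
  refine iSup_le fun x => ?_
  rw [MeasurableSpace.comap_iSup]
  refine iSup_le fun hx => ?_
  rw [MeasurableSpace.comap_comp]
  exact measurable_iff_comap_le.1 (measurable_apply_sigmaOn (mem_image_of_mem (· + y) hx))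

instance secondCountable_spd : SecondCountableTopology (SPD d) := by
  have : SecondCountableTopology (Matrix (Fin d) (Fin d) ℝ) :=
    inferInstanceAs (SecondCountableTopology (Fin d → Fin d → ℝ))
  exact TopologicalSpace.Subtype.secondCountableTopology _

lemma measurable_sqrt_quadForm (v : EuclideanSpace ℝ (Fin d)) :
    Measurable fun A : SPD d => Real.sqrt (v.ofLp ⬝ᵥ (A.1.mulVec v.ofLp)) := by
  refine Continuous.measurable ?_
  refine Real.continuous_sqrt.comp ?_
  fun_prop

lemma measurable_inf'_apply {Ω : Type*} [MeasurableSpace Ω] {ι : Type*} {s : Finset ι}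
    (hs : s.Nonempty) {f : ι → Ω → ℝ} (hf : ∀ i ∈ s, Measurable (f i)) :
    Measurable fun ω => s.inf' hs fun i => f i ω := by
  simp only [← Finset.inf'_apply]
  exact Finset.inf'_induction hs _ (fun _ h _ h' => h.inf h') hf

lemma measurable_speedBound_comp {Ω : Type*} [MeasurableSpace Ω] {G : Ω → RMetric d}
    {x : EuclideanSpace ℝ (Fin d)} (h : Measurable fun ω => G ω x) :
    Measurable fun ω => speedBound (G ω) x :=
  (continuous_trace.measurable.comp h).const_add 1

/-- The sigma-algebra is left arbitrary so that the result also applies to `sigmaOn A`, where it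
expresses locality. The integrand is continuous in time and measurable in the metric, hence jointly
measurable. -/
lemma measurable_curveLength_comp {Ω : Type*} [MeasurableSpace Ω] {G : Ω → RMetric d}
    {γ : ℝ → EuclideanSpace ℝ (Fin d)} (hγ : ContDiff ℝ 1 γ)
    (h : ∀ t, Measurable fun ω => G ω (γ t)) : Measurable fun ω => curveLength (G ω) γ := by
  have hu : Measurable (Function.uncurry fun (t : ℝ) (ω : Ω) =>
      tangentNorm (G ω) (γ t) (deriv γ t)) :=
    measurable_uncurry_of_continuous_of_measurable
      (fun ω => continuous_tangentNorm_comp continuous_const hγ.continuous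
        (hγ.continuous_deriv le_rfl))
      (fun t => (measurable_sqrt_quadForm (deriv γ t)).comp (h t))
  simp only [curveLength, intervalIntegral.integral_of_le zero_le_one]
  exact (StronglyMeasurable.integral_prod_left hu.stronglyMeasurable).measurable

lemma measurable_curveLength_sigmaOn {A : Set (EuclideanSpace ℝ (Fin d))}
    {γ : ℝ → EuclideanSpace ℝ (Fin d)} (hγ : ContDiff ℝ 1 γ) (h : ∀ t, γ t ∈ A) :
    Measurable[sigmaOn A] fun g : RMetric d => curveLength g γ :=
  @measurable_curveLength_comp d (RMetric d) (sigmaOn A) id γ hγ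
    fun t => measurable_apply_sigmaOn (h t)

lemma continuous_curveLength {γ : ℝ → EuclideanSpace ℝ (Fin d)} (hγ : ContDiff ℝ 1 γ) :
    Continuous fun g : RMetric d => curveLength g γ := by
  unfold curveLength
  refine intervalIntegral.continuous_parametric_intervalIntegral_of_continuous' ?_ 0 1
  exact continuous_tangentNorm_comp continuous_fst (hγ.continuous.comp continuous_snd)
    ((hγ.continuous_deriv le_rfl).comp continuous_snd)

/-- A single sequence of curves computes the distance for every metric. -/
lemma exists_seq_restCurves (x y : EuclideanSpace ℝ (Fin d)) :
    ∃ Γ : ℕ → ℝ → EuclideanSpace ℝ (Fin d), (∀ n, Γ n ∈ restCurves x y) ∧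
      ∀ g : RMetric d, riemDist g x y = ⨅ n, curveLength g (Γ n) := by
  -- Lindelöf argument: length is continuous for the compact-open topology, so the sets of metrics
  -- giving a curve length below `q` are open, and countably many of them have the same union.
  have hopen : ∀ q : ℚ, ∃ T : Set (restCurves x y), T.Countable ∧
      ⋃ γ ∈ T, {g : RMetric d | curveLength g γ.1 < q}
        = ⋃ γ : restCurves x y, {g | curveLength g γ.1 < q} :=
    fun q => TopologicalSpace.isOpen_iUnion_countable
      (fun γ : restCurves x y => {g : RMetric d | curveLength g γ.1 < q}) fun γ =>
      isOpen_lt (continuous_curveLength γ.2.1) continuous_const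
  choose T hT hTU using hopen
  obtain ⟨γ₀, hγ₀⟩ := restCurves_nonempty x y
  have hc : (insert ⟨γ₀, hγ₀⟩ (⋃ q, T q) : Set (restCurves x y)).Countable :=
    (countable_iUnion hT).insert _
  obtain ⟨Γ, hΓ⟩ := hc.exists_eq_range (insert_nonempty _ _)
  refine ⟨fun n => (Γ n).1, fun n => (Γ n).2, fun g => ?_⟩
  have hbdd : BddBelow (range fun n => curveLength g (Γ n).1) :=
    ⟨0, by rintro _ ⟨γ, rfl⟩; exact curveLength_nonneg g _⟩
  refine le_antisymm (le_ciInf fun n => riemDist_le_curveLength g (Γ n).2)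
    (le_of_forall_gt fun r hr => ?_)
  obtain ⟨q, hq1, hq2⟩ := exists_rat_btwn hr
  obtain ⟨γ, hγ, h1⟩ := exists_curveLength_lt hq1
  have : g ∈ ⋃ γ : restCurves x y, {g : RMetric d | curveLength g γ.1 < q} :=
    mem_iUnion.2 ⟨⟨γ, hγ⟩, h1⟩
  rw [← hTU q] at this
  obtain ⟨η, hη, h2⟩ := mem_iUnion₂.1 this
  have : η ∈ range Γ := hΓ ▸ mem_insert_of_mem _ (mem_iUnion.2 ⟨q, hη⟩)
  obtain ⟨n, rfl⟩ := this
  exact (ciInf_le hbdd n).trans_lt (lt_trans h2 hq2)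

lemma measurable_riemDist (x y : EuclideanSpace ℝ (Fin d)) :
    Measurable fun g : RMetric d => riemDist g x y := by
  obtain ⟨Γ, hΓ, h⟩ := exists_seq_restCurves x y
  simp only [h]
  exact Measurable.iInf fun n =>
    measurable_curveLength_comp (hΓ n).1 fun t => measurable_apply _

lemma exists_bound_restCurve {x y : EuclideanSpace ℝ (Fin d)}
    {γ : ℝ → EuclideanSpace ℝ (Fin d)} (hγ : γ ∈ restCurves x y) :
    ∃ K, ∀ t, γ t ∈ Metric.closedBall (0 : EuclideanSpace ℝ (Fin d)) K := by
  obtain ⟨K, hK⟩ := ((isCompact_Icc (a := (0 : ℝ)) (b := 1)).image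
    hγ.1.continuous).isBounded.subset_closedBall 0
  have h : ∀ t ∈ Icc (0 : ℝ) 1, γ t ∈ Metric.closedBall 0 K := fun t ht =>
    hK (mem_image_of_mem _ ht)
  refine ⟨K, fun t => ?_⟩
  rcases le_total t 0 with ht | ht
  · rw [hγ.2.1 t ht, ← hγ.2.1 0 le_rfl]; exact h 0 (by simp)
  rcases le_total t 1 with ht' | ht'
  · exact h t ⟨ht, ht'⟩
  · rw [hγ.2.2 t ht', ← hγ.2.2 1 le_rfl]; exact h 1 (by simp)

end Measurability

/-! ### Integrability and local approximation of the distance. -/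

section Integrability

variable {d : ℕ} {P : Measure (RMetric d)} [IsProbabilityMeasure P]

/-- The average of the squared speed bound along a curve. -/
noncomputable def squareAverage (g : RMetric d) (γ : ℝ → EuclideanSpace ℝ (Fin d)) : ℝ :=
  ∫ t in (0 : ℝ)..1, speedBound g (γ t) ^ 2

/-- Fubini and stationarity: every point of the curve contributes the same mean. The value does not
depend on the curve, which later gives bounds uniform in its length. -/
lemma integrable_and_integral_squareAverage (hP : TranslationInvariant P)
    (h2 : Integrable (fun g => speedBound g 0 ^ 2) P) {γ : ℝ → EuclideanSpace ℝ (Fin d)}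
    (hγ : Continuous γ) : Integrable (fun g => squareAverage g γ) P ∧
      ∫ g, squareAverage g γ ∂P = ∫ g, speedBound g 0 ^ 2 ∂P := by
  have hx : ∀ x, Integrable (fun g => speedBound g x ^ 2) P ∧
      ∫ g, speedBound g x ^ 2 ∂P = ∫ g, speedBound g 0 ^ 2 ∂P := fun x => by
    have h3 := hP x
    have h4 : (fun g : RMetric d => speedBound g x ^ 2)
        = (fun g => speedBound g 0 ^ 2) ∘ shift x := by
      ext g; simp
    have h5 := h2
    rw [← h3.map_eq] at h5
    constructor
    · rw [h4]; exact h3.integrable_comp_of_integrable h2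
    · conv_rhs => rw [← h3.map_eq]
      rw [integral_map h3.measurable.aemeasurable h5.aestronglyMeasurable]
      simp
  set ν : Measure ℝ := volume.restrict (Ioc 0 1)
  have hm : Measurable (fun p : RMetric d × ℝ => speedBound p.1 (γ p.2) ^ 2) := by
    have h : Measurable (Function.uncurry fun (t : ℝ) (g : RMetric d) => speedBound g (γ t)) :=
      measurable_uncurry_of_continuous_of_measurable
        (fun g => (continuous_speedBound g).comp hγ)
        (fun t => measurable_speedBound_comp (G := id) (measurable_apply (γ t)))
    have h' : Measurable fun p : RMetric d × ℝ => speedBound p.1 (γ p.2) := by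
      simpa [Function.comp_def, Function.uncurry] using h.comp measurable_swap
    exact h'.pow_const 2
  have hint : Integrable (fun p : RMetric d × ℝ => speedBound p.1 (γ p.2) ^ 2) (P.prod ν) := by
    refine (integrable_prod_iff' hm.aestronglyMeasurable).2
      ⟨Eventually.of_forall fun t => (hx (γ t)).1, ?_⟩
    simp only [Real.norm_eq_abs, abs_pow, sq_abs, (hx _).2]
    exact integrable_const _
  simp only [squareAverage, intervalIntegral.integral_of_le zero_le_one]
  refine ⟨hint.integral_prod_left, ?_⟩
  rw [integral_integral_swap hint]
  simp [(hx _).2]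

lemma integrable_squareAverage (hP : TranslationInvariant P)
    (h2 : Integrable (fun g => speedBound g 0 ^ 2) P) {γ : ℝ → EuclideanSpace ℝ (Fin d)}
    (hγ : Continuous γ) : Integrable (fun g => squareAverage g γ) P :=
  (integrable_and_integral_squareAverage hP h2 hγ).1

lemma speedBound_le_sq (g : RMetric d) (x : EuclideanSpace ℝ (Fin d)) :
    speedBound g x ≤ speedBound g x ^ 2 := by
  nlinarith [one_le_speedBound g x]

lemma integrable_curveLength (hP : TranslationInvariant P)
    (h2 : Integrable (fun g => speedBound g 0 ^ 2) P) {γ : ℝ → EuclideanSpace ℝ (Fin d)}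
    (hγ : ContDiff ℝ 1 γ) : Integrable (fun g => curveLength g γ) P := by
  have hd : Continuous (deriv γ) := hγ.continuous_deriv le_rfl
  obtain ⟨K, hK⟩ := (isCompact_Icc (a := (0 : ℝ)) (b := 1)).exists_bound_of_continuousOn
    hd.continuousOn
  refine Integrable.mono' ((integrable_squareAverage hP h2 hγ.continuous).const_mul K)
    (measurable_curveLength_comp hγ fun t => measurable_apply _).aestronglyMeasurable
    (Eventually.of_forall fun g => ?_)
  rw [Real.norm_of_nonneg (curveLength_nonneg g γ), squareAverage,
    ← intervalIntegral.integral_const_mul]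
  refine intervalIntegral.integral_mono_on zero_le_one
    ((continuous_tangentNorm_comp continuous_const hγ.continuous hd).intervalIntegrable _ _)
    (((((continuous_speedBound g).comp hγ.continuous).pow 2).const_mul K).intervalIntegrable _ _)
    fun t ht => ?_
  refine (tangentNorm_le _ _ _).trans ?_
  rw [mul_comm]
  exact mul_le_mul (hK t ht) (speedBound_le_sq g _) (speedBound_nonneg _ _)
    ((norm_nonneg _).trans (hK t ht))

lemma integrable_riemDist (hP : TranslationInvariant P)
    (h2 : Integrable (fun g => speedBound g 0 ^ 2) P) (x y : EuclideanSpace ℝ (Fin d)) :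
    Integrable (fun g => riemDist g x y) P := by
  obtain ⟨γ, hγ⟩ := restCurves_nonempty x y
  refine Integrable.mono' (integrable_curveLength hP h2 hγ.1)
    (measurable_riemDist x y).aestronglyMeasurable (Eventually.of_forall fun g => ?_)
  rw [Real.norm_of_nonneg (riemDist_nonneg g x y)]
  exact riemDist_le_curveLength g hγ

/-- The distance is dominated, up to a small error in mean, by a local quantity. -/
lemma exists_local_upper_bound (hP : TranslationInvariant P)
    (h2 : Integrable (fun g => speedBound g 0 ^ 2) P) (x y : EuclideanSpace ℝ (Fin d))
    {ε : ℝ} (hε : 0 < ε) :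
    ∃ (Y : RMetric d → ℝ) (K : ℝ), Measurable[sigmaOn (Metric.closedBall 0 K)] Y ∧
      (∀ g, riemDist g x y ≤ Y g) ∧ Integrable Y P ∧
      ∫ g, Y g ∂P ≤ ∫ g, riemDist g x y ∂P + ε := by
  obtain ⟨Γ, hΓ, h⟩ := exists_seq_restCurves x y
  choose K hK using fun n => exists_bound_restCurve (hΓ n)
  -- The minimum over finitely many curves of the sequence sees only a ball containing them. It
  -- converges to the distance as curves are added, dominated by the length of the first one.
  set Y : ℕ → RMetric d → ℝ := fun k g =>
    (Finset.range (k + 1)).inf' Finset.nonempty_range_add_one fun i => curveLength g (Γ i) with hY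
  set K' : ℕ → ℝ := fun k =>
    (Finset.range (k + 1)).sup' Finset.nonempty_range_add_one K with hK'
  have hYm : ∀ k, Measurable[sigmaOn (Metric.closedBall 0 (K' k))] (Y k) := fun k => by
    refine @measurable_inf'_apply (RMetric d) (sigmaOn (Metric.closedBall 0 (K' k))) _ _ _ _
      fun i hi => measurable_curveLength_sigmaOn (hΓ i).1 fun t => ?_
    exact Metric.closedBall_subset_closedBall (Finset.le_sup' K hi) (hK i t)
  have hYle : ∀ k g, riemDist g x y ≤ Y k g := fun k g =>
    Finset.le_inf' _ _ fun i _ => riemDist_le_curveLength g (hΓ i)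
  have hY0 : ∀ k g, Y k g ≤ curveLength g (Γ 0) := fun k g =>
    Finset.inf'_le _ (by simp)
  have hYi : ∀ k, Integrable (Y k) P := fun k => by
    refine Integrable.mono' (integrable_curveLength hP h2 (hΓ 0).1)
      ((hYm k).mono (sigmaOn_le _) le_rfl).aestronglyMeasurable (Eventually.of_forall fun g => ?_)
    rw [Real.norm_of_nonneg ((riemDist_nonneg g x y).trans (hYle k g))]
    exact hY0 k g
  have hlim : ∀ g, Tendsto (fun k => Y k g) atTop (𝓝 (riemDist g x y)) := fun g => by
    refine tendsto_order.2 ⟨fun r hr => Eventually.of_forall fun k => hr.trans_le (hYle k g),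
      fun r hr => ?_⟩
    rw [h g] at hr
    obtain ⟨n, hn⟩ := exists_lt_of_ciInf_lt hr
    filter_upwards [eventually_ge_atTop n] with k hk
    exact (Finset.inf'_le _ (by simp; omega)).trans_lt hn
  have hI : Tendsto (fun k => ∫ g, Y k g ∂P) atTop (𝓝 (∫ g, riemDist g x y ∂P)) := by
    refine tendsto_integral_of_dominated_convergence (fun g => curveLength g (Γ 0))
      (fun k => (hYi k).aestronglyMeasurable) (integrable_curveLength hP h2 (hΓ 0).1)
      (fun k => Eventually.of_forall fun g => ?_) (Eventually.of_forall hlim)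
    rw [Real.norm_of_nonneg ((riemDist_nonneg g x y).trans (hYle k g))]
    exact hY0 k g
  obtain ⟨k, hk⟩ := (hI.eventually (gt_mem_nhds (lt_add_of_pos_right _ hε))).exists
  exact ⟨Y k, K' k, hYm k, hYle k, hYi k, hk.le⟩

end Integrability

/-! ### Paths through unit cubes and deterministic distance bounds. -/

section Cubes

variable {d : ℕ}

/-- A lattice point as a point of Euclidean space. -/
def latticePoint (z : Fin d → ℤ) : EuclideanSpace ℝ (Fin d) := WithLp.toLp 2 fun i => (z i : ℝ)

@[simp] lemma latticePoint_apply (z : Fin d → ℤ) (i : Fin d) : latticePoint z i = z i := rfl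

/-- The supremum of the speed bound over a unit cube. -/
noncomputable def cubeBound (g : RMetric d) (z : Fin d → ℤ) : ℝ :=
  sSup (speedBound g '' unitCube z)

lemma exists_isCompact_unitCube_subset (z : Fin d → ℤ) : ∃ K, IsCompact K ∧ unitCube z ⊆ K := by
  refine ⟨WithLp.toLp 2 '' (Set.pi univ fun i => Icc ((z i : ℝ) - 1 / 2) ((z i : ℝ) + 1 / 2)),
    (isCompact_univ_pi fun i => isCompact_Icc).image (PiLp.continuous_toLp 2 _), fun x hx => ?_⟩
  exact ⟨x.ofLp, fun i _ => Ico_subset_Icc_self (hx i), rfl⟩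

lemma bddAbove_image_unitCube {f : EuclideanSpace ℝ (Fin d) → ℝ} (hf : Continuous f)
    (z : Fin d → ℤ) : BddAbove (f '' unitCube z) := by
  obtain ⟨K, hK, h⟩ := exists_isCompact_unitCube_subset z
  exact (hK.bddAbove_image hf.continuousOn).mono (image_mono h)

lemma latticePoint_mem_unitCube (z : Fin d → ℤ) : latticePoint z ∈ unitCube z := fun i => by
  constructor <;> simp

lemma speedBound_le_cubeBound (g : RMetric d) {z : Fin d → ℤ} {x : EuclideanSpace ℝ (Fin d)}
    (hx : x ∈ unitCube z) : speedBound g x ≤ cubeBound g z :=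
  le_csSup (bddAbove_image_unitCube (continuous_speedBound g) z) (mem_image_of_mem _ hx)

lemma one_le_cubeBound (g : RMetric d) (z : Fin d → ℤ) : 1 ≤ cubeBound g z :=
  (one_le_speedBound g _).trans (speedBound_le_cubeBound g (latticePoint_mem_unitCube z))

lemma cubeBound_nonneg (g : RMetric d) (z : Fin d → ℤ) : 0 ≤ cubeBound g z :=
  zero_le_one.trans (one_le_cubeBound g z)

lemma cubeBound_shift (g : RMetric d) (w z : Fin d → ℤ) :
    cubeBound (shift (latticePoint w) g) z = cubeBound g (z + w) := by
  unfold cubeBound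
  congr 1
  ext r
  simp only [mem_image, speedBound_shift]
  constructor
  · rintro ⟨x, hx, rfl⟩
    refine ⟨x + latticePoint w, fun i => ?_, rfl⟩
    have := hx i
    simp only [mem_Ico, PiLp.add_apply, latticePoint_apply, Pi.add_apply, Int.cast_add] at this ⊢
    constructor <;> linarith [this.1, this.2]
  · rintro ⟨x, hx, rfl⟩
    refine ⟨x - latticePoint w, fun i => ?_, by simp⟩
    have := hx i
    simp only [mem_Ico, PiLp.sub_apply, latticePoint_apply, Pi.add_apply, Int.cast_add] at this ⊢
    constructor <;> linarith [this.1, this.2]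

/-- By continuity the supremum is determined by a countable dense subset of the cube. -/
lemma measurable_cubeBound_comp {Ω : Type*} [MeasurableSpace Ω] {G : Ω → RMetric d}
    {z : Fin d → ℤ} (h : ∀ x ∈ unitCube z, Measurable fun ω => G ω x) :
    Measurable fun ω => cubeBound (G ω) z := by
  obtain ⟨D, hD, hDd⟩ := TopologicalSpace.exists_countable_dense (unitCube z)
  have key : ∀ (g : RMetric d) (c : ℝ), cubeBound g z ≤ c ↔ ∀ x ∈ D, speedBound g x.1 ≤ c := by
    intro g c
    constructor
    · exact fun h x _ => (speedBound_le_cubeBound g x.2).trans h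
    · intro h
      refine csSup_le (Nonempty.image _ ⟨_, latticePoint_mem_unitCube z⟩) ?_
      rintro _ ⟨x, hx, rfl⟩
      have hcl : IsClosed {x : unitCube z | speedBound g x.1 ≤ c} :=
        isClosed_le ((continuous_speedBound g).comp continuous_subtype_val) continuous_const
      exact hcl.closure_subset_iff.2 h (hDd ⟨x, hx⟩)
  refine measurable_of_Iic fun c => ?_
  have hpre : (fun ω => cubeBound (G ω) z) ⁻¹' Iic c
      = ⋂ x ∈ D, {ω | speedBound (G ω) x.1 ≤ c} := by
    ext ω; simpa using key (G ω) c
  rw [hpre]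
  exact MeasurableSet.biInter hD fun x _ =>
    measurableSet_le (measurable_speedBound_comp (h x.1 x.2)) measurable_const

lemma measurable_cubeBound_sigmaOn (z : Fin d → ℤ) :
    Measurable[sigmaOn (unitCube z)] fun g : RMetric d => cubeBound g z :=
  @measurable_cubeBound_comp d (RMetric d) (sigmaOn (unitCube z)) id z
    fun _ hx => measurable_apply_sigmaOn hx

lemma segment_apply_mem {x y : EuclideanSpace ℝ (Fin d)} {z : Fin d → ℤ} (hx : x ∈ unitCube z)
    (hy : y ∈ unitCube z) {t : ℝ} (ht : t ∈ Icc (0 : ℝ) 1) : x + t • (y - x) ∈ unitCube z := by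
  intro i
  exact (convex_Ico _ _).add_smul_sub_mem (hx i) (hy i) ht

lemma riemDist_le_mul_cubeBound (g : RMetric d) {x y : EuclideanSpace ℝ (Fin d)} {z : Fin d → ℤ}
    (hx : x ∈ unitCube z) (hy : y ∈ unitCube z) :
    riemDist g x y ≤ ‖y - x‖ * cubeBound g z :=
  riemDist_le_of_speedBound_le g fun _ ht => speedBound_le_cubeBound g (segment_apply_mem hx hy ht)

lemma riemDist_latticePoint_step (g : RMetric d) (z : Fin d → ℤ) (j : Fin d) :
    riemDist g (latticePoint z) (latticePoint (z + Pi.single j 1))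
      ≤ cubeBound g z + cubeBound g (z + Pi.single j 1) := by
  have hd : latticePoint (z + Pi.single j 1) - latticePoint z = EuclideanSpace.single j (1 : ℝ) := by
    ext i
    rcases eq_or_ne i j with rfl | h <;> simp [*]
  have := riemDist_le_of_speedBound_le g (x := latticePoint z)
    (y := latticePoint (z + Pi.single j 1)) (K := cubeBound g z + cubeBound g (z + Pi.single j 1))
    fun t ht => ?_
  · rwa [hd, PiLp.norm_single, norm_one, one_mul] at this
  · rw [hd]
    -- The midpoint lies on the common face, which belongs to the second cube because cubes are
    -- half-open.
    rcases lt_or_ge t (1 / 2) with h | h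
    · refine (speedBound_le_cubeBound g (z := z) fun i => ?_).trans
        (le_add_of_nonneg_right (cubeBound_nonneg _ _))
      rcases eq_or_ne i j with rfl | hi
      · simp only [PiLp.add_apply, latticePoint_apply, PiLp.smul_apply,
          PiLp.single_apply, smul_eq_mul, if_true, mem_Ico]
        constructor <;> linarith [ht.1, ht.2]
      · constructor <;> simp [hi]
    · refine (speedBound_le_cubeBound g (z := z + Pi.single j 1) fun i => ?_).trans
        (le_add_of_nonneg_left (cubeBound_nonneg _ _))
      rcases eq_or_ne i j with rfl | hi
      · simp only [PiLp.add_apply, latticePoint_apply, PiLp.smul_apply, Pi.add_apply,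
          PiLp.single_apply, smul_eq_mul, if_true, mem_Ico, Pi.single_eq_same,
          Int.cast_add, Int.cast_one]
        constructor <;> linarith [ht.1, ht.2]
      · constructor <;> simp [hi]

lemma riemDist_latticePoint_axis (g : RMetric d) (z : Fin d → ℤ) (j : Fin d) (m : ℕ) :
    riemDist g (latticePoint z) (latticePoint (z + m • Pi.single j 1))
      ≤ 2 * ∑ i ∈ Finset.range (m + 1), cubeBound g (z + i • Pi.single j 1) := by
  -- The extra last term makes the induction close: each step pays once for the cube it leaves and
  -- once for the cube it enters.
  suffices h : riemDist g (latticePoint z) (latticePoint (z + m • Pi.single j 1))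
      + cubeBound g (z + m • Pi.single j 1)
      ≤ 2 * ∑ i ∈ Finset.range (m + 1), cubeBound g (z + i • Pi.single j 1) by
    linarith [cubeBound_nonneg g (z + m • Pi.single j 1)]
  induction m with
  | zero =>
    have := cubeBound_nonneg g z
    simp [riemDist_self]; linarith
  | succ m ih =>
    rw [Finset.sum_range_succ]
    have h1 := riemDist_triangle g (latticePoint z) (latticePoint (z + m • Pi.single j 1))
      (latticePoint (z + (m + 1) • Pi.single j 1))
    have h2 := riemDist_latticePoint_step g (z + m • Pi.single j 1) j
    rw [add_assoc, ← succ_nsmul] at h2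
    linarith

/-- All sums of `cubeBound` over axis-parallel rows of `m` cubes that start in the box of radius
`r` are below `K`. -/
def RowBound (g : RMetric d) (r m : ℕ) (K : ℝ) : Prop :=
  ∀ z : Fin d → ℤ, (∀ i, |z i| ≤ r) → ∀ j,
    ∑ i ∈ Finset.range m, cubeBound g (z + i • Pi.single j 1) < K

lemma RowBound.riemDist_update_le {g : RMetric d} {r m : ℕ} {K : ℝ} (h : RowBound g r m K)
    {z : Fin d → ℤ} (hz : ∀ i, |z i| ≤ r) (j : Fin d) {c : ℤ} (hc : |c| ≤ r)
    (hcz : |c - z j| < m) :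
    riemDist g (latticePoint z) (latticePoint (Function.update z j c)) ≤ 2 * K := by
  have key : ∀ (w : Fin d → ℤ), (∀ i, |w i| ≤ r) → ∀ n : ℕ, n < m →
      riemDist g (latticePoint w) (latticePoint (w + n • Pi.single j 1)) ≤ 2 * K := by
    intro w hw n hn
    refine (riemDist_latticePoint_axis g w j n).trans ?_
    have h1 := h w hw j
    have h2 : ∑ i ∈ Finset.range (n + 1), cubeBound g (w + i • Pi.single j 1)
        ≤ ∑ i ∈ Finset.range m, cubeBound g (w + i • Pi.single j 1) :=
      Finset.sum_le_sum_of_subset_of_nonneg (Finset.range_mono hn)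
        fun i _ _ => cubeBound_nonneg _ _
    linarith
  rcases le_total (z j) c with hle | hle
  · obtain ⟨n, hn⟩ := Int.eq_ofNat_of_zero_le (sub_nonneg.2 hle)
    have e : Function.update z j c = z + n • Pi.single j 1 := by
      ext i
      rcases eq_or_ne i j with rfl | hi
      · simp; linarith
      · simp [hi]
    rw [e]
    refine key z hz n ?_
    rw [hn] at hcz
    simpa using hcz
  -- Rows run only in the positive direction, so this case starts at the other endpoint and uses
  -- symmetry of the distance.
  · obtain ⟨n, hn⟩ := Int.eq_ofNat_of_zero_le (sub_nonneg.2 hle)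
    have e : z = Function.update z j c + n • Pi.single j 1 := by
      ext i
      rcases eq_or_ne i j with rfl | hi
      · simp; linarith
      · simp [hi]
    rw [riemDist_comm]
    have hu : ∀ i, |Function.update z j c i| ≤ r := fun i => by
      rcases eq_or_ne i j with rfl | hi
      · simpa using hc
      · simpa [hi] using hz i
    have h3 := key (Function.update z j c) hu n (by
      rw [abs_sub_comm, hn] at hcz
      simpa using hcz)
    rwa [← e] at h3

/-- The coordinates are corrected one at a time. Intermediate points take each coordinate from `z`
or `w`, so they stay in the box. -/
lemma RowBound.riemDist_le_card {g : RMetric d} {r m : ℕ} {K : ℝ} (h : RowBound g r m K)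
    (s : Finset (Fin d)) : ∀ {z w : Fin d → ℤ}, (∀ i, |z i| ≤ r) → (∀ i, |w i| ≤ r) →
    (∀ i, |w i - z i| < m) → (∀ i ∉ s, z i = w i) →
    riemDist g (latticePoint z) (latticePoint w) ≤ s.card * (2 * K) := by
  induction s using Finset.induction_on with
  | empty =>
    intro z w _ _ _ hs
    rw [show z = w from funext fun i => hs i (by simp), riemDist_self]
    simp
  | insert j s hj ih =>
    intro z w hz hw hzw hs
    have h1 := h.riemDist_update_le hz j (hw j) (hzw j)
    have h2 := ih (z := Function.update z j (w j)) (w := w)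
      (fun i => by
        rcases eq_or_ne i j with rfl | hi
        · simpa using hw i
        · simpa [hi] using hz i) hw
      (fun i => by
        rcases eq_or_ne i j with rfl | hi
        · simpa using (abs_nonneg _).trans_lt (hzw i)
        · simpa [hi] using hzw i)
      (fun i hi => by
        rcases eq_or_ne i j with rfl | hij
        · simp
        · simpa [hij] using hs i (by simp [hij, hi]))
    have h3 := riemDist_triangle g (latticePoint z) (latticePoint (Function.update z j (w j)))
      (latticePoint w)
    rw [Finset.card_insert_of_notMem hj]
    push_cast
    linarith

/-- The lattice point whose unit cube contains `x`. -/
noncomputable def roundPoint (x : EuclideanSpace ℝ (Fin d)) : Fin d → ℤ := fun i => ⌊x i + 1 / 2⌋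

lemma mem_unitCube_roundPoint (x : EuclideanSpace ℝ (Fin d)) : x ∈ unitCube (roundPoint x) :=
  fun i => by
    have h1 := Int.floor_le (x i + 1 / 2)
    have h2 := Int.lt_floor_add_one (x i + 1 / 2)
    simp only [roundPoint, mem_Ico]
    constructor <;> linarith

lemma norm_le_of_forall_abs_le {x : EuclideanSpace ℝ (Fin d)} {c : ℝ} (h : ∀ i, |x i| ≤ c) :
    ‖x‖ ≤ d * c := by
  have h1 : ‖x‖ ≤ ∑ i, ‖EuclideanSpace.single i (x i)‖ := by
    conv_lhs => rw [show x = ∑ i, EuclideanSpace.single i (x i) by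
      ext j; simp]
    exact norm_sum_le _ _
  refine h1.trans ?_
  simpa using Finset.sum_le_card_nsmul Finset.univ (fun i => ‖EuclideanSpace.single i (x i)‖) c
    fun i _ => by simpa using h i

lemma RowBound.riemDist_roundPoint_le {g : RMetric d} {r m : ℕ} {K : ℝ} (h : RowBound g r m K)
    (j : Fin d) (hm : 0 < m) {x : EuclideanSpace ℝ (Fin d)} (hx : ∀ i, |roundPoint x i| ≤ r) :
    riemDist g x (latticePoint (roundPoint x)) ≤ d * K := by
  have hmem := mem_unitCube_roundPoint x
  have h0 := h _ hx j
  have h1 : cubeBound g (roundPoint x) ≤ K := by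
    refine le_trans ?_ h0.le
    have h2 := Finset.single_le_sum
      (f := fun i : ℕ => cubeBound g (roundPoint x + i • Pi.single j 1))
      (fun i _ => cubeBound_nonneg _ _) (Finset.mem_range.2 hm)
    simpa only [zero_nsmul, add_zero] using h2
  refine (riemDist_le_mul_cubeBound g hmem (latticePoint_mem_unitCube _)).trans
    (mul_le_mul ?_ h1 (cubeBound_nonneg _ _) (Nat.cast_nonneg d))
  have := norm_le_of_forall_abs_le (x := latticePoint (roundPoint x) - x) (c := 1) fun i => by
    have := hmem i
    simp only [PiLp.sub_apply, latticePoint_apply]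
    rw [abs_le]
    constructor <;> linarith [this.1, this.2]
  simpa using this

/-- Rounding `x` and `y` costs `d * K` each and the lattice path between the rounded points `2 * d *
K`. The margins `1 / 2` and `1` absorb the rounding errors. -/
lemma RowBound.riemDist_le {g : RMetric d} {r m : ℕ} {K : ℝ} (h : RowBound g r m K)
    (j : Fin d) (hm : 0 < m) {x y : EuclideanSpace ℝ (Fin d)} (hx : ∀ i, |x i| + 1 / 2 ≤ r)
    (hy : ∀ i, |y i| + 1 / 2 ≤ r) (hxy : ∀ i, |y i - x i| + 1 < m) :
    riemDist g x y ≤ 4 * d * K := by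
  have hround : ∀ (u : EuclideanSpace ℝ (Fin d)) i, |(roundPoint u i : ℝ) - u i| ≤ 1 / 2 := by
    intro u i
    have := mem_unitCube_roundPoint u i
    rw [abs_le]
    constructor <;> linarith [this.1, this.2]
  have hbox : ∀ u : EuclideanSpace ℝ (Fin d), (∀ i, |u i| + 1 / 2 ≤ r) →
      ∀ i, |roundPoint u i| ≤ r := by
    intro u hu i
    have h1 := hround u i
    have h2 := hu i
    have : |(roundPoint u i : ℝ)| ≤ r := by
      rw [abs_le] at *
      have := abs_le.1 (le_sub_iff_add_le.2 h2)
      constructor <;> linarith [this.1, this.2, h1.1, h1.2]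
    exact_mod_cast this
  have h1 := h.riemDist_roundPoint_le j hm (hbox x hx)
  have h2 := h.riemDist_roundPoint_le j hm (hbox y hy)
  have h3 := h.riemDist_le_card Finset.univ (hbox x hx) (hbox y hy) (fun i => by
    have h1 := abs_le.1 (hround x i)
    have h2 := abs_le.1 (hround y i)
    have h3 := hxy i
    have h4 := abs_lt.1 (lt_sub_iff_add_lt.2 h3)
    have : |(roundPoint y i : ℝ) - roundPoint x i| < m := by
      rw [abs_lt]
      constructor <;> linarith [h1.1, h1.2, h2.1, h2.2, h4.1, h4.2]
    exact_mod_cast this) (by simp)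
  rw [riemDist_comm] at h2
  have h4 := riemDist_triangle g x (latticePoint (roundPoint x)) y
  have h5 := riemDist_triangle g (latticePoint (roundPoint x)) (latticePoint (roundPoint y)) y
  simp only [Finset.card_univ, Fintype.card_fin] at h3
  linarith

end Cubes

/-! ### A covering argument for subadditive processes. -/

section Subadditive

variable {Ω : Type*}

/-- Cutting a trajectory into blocks on which a subadditive process is small. -/
lemma subadditive_tiling {T : Ω → Ω} {X : ℕ → Ω → ℝ} {f : Ω → ℝ} {A : Set Ω} {N : ℕ}
    {φ : ℕ → Ω → ℝ} (hX0 : ∀ ω, X 0 ω ≤ 0)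
    (hXadd : ∀ m n ω, X (m + n) ω ≤ X m ω + X n (T^[m] ω))
    (hf : ∀ ω, 0 ≤ f ω) (hfT : ∀ ω, f (T ω) ≤ f ω)
    (hA : ∀ ω ∈ A, ∃ n, 1 ≤ n ∧ n ≤ N ∧ X n ω ≤ n * f ω)
    (hφ : ∀ r ω, 0 ≤ φ r ω) (hφ1 : ∀ r ω, r ≤ N ∨ ω ∉ A → X 1 ω ≤ φ r ω) (M : ℕ) (ω : Ω) :
    X M ω ≤ M * f ω + ∑ k ∈ Finset.range M, φ (M - k) (T^[k] ω) := by
  have hfT' : ∀ n ω, f (T^[n] ω) ≤ f ω := by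
    intro n
    induction n with
    | zero => intro ω; simp
    | succ n ih => intro ω; rw [Function.iterate_succ_apply]; exact (ih _).trans (hfT ω)
  induction M using Nat.strong_induction_on generalizing ω with
  | _ M ih =>
    rcases Nat.eq_zero_or_pos M with rfl | hM
    · simpa using hX0 ω
    -- After a block of length `n` the induction hypothesis applies at `T^[n] ω`; since `f` does not
    -- increase along the orbit, the rest is charged at the initial value `f ω`.
    have tail : ∀ n, 1 ≤ n → n ≤ M → X (M - n) (T^[n] ω)
        ≤ (M - n : ℝ) * f ω + ∑ k ∈ Finset.Ico n M, φ (M - k) (T^[k] ω) := by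
      intro n hn hnM
      refine (ih (M - n) (by omega) (T^[n] ω)).trans (add_le_add ?_ (le_of_eq ?_))
      · rw [Nat.cast_sub hnM]
        exact mul_le_mul_of_nonneg_left (hfT' n ω) (sub_nonneg.2 (by exact_mod_cast hnM))
      · rw [Finset.sum_Ico_eq_sum_range]
        refine Finset.sum_congr rfl fun k _ => ?_
        rw [← Function.iterate_add_apply, Nat.sub_sub, add_comm k n]
    -- With little time left, or at a point outside `A`, advance one step and pay `φ`; otherwise
    -- advance by a whole cheap block, which fits into the remaining time.
    by_cases hc : M ≤ N ∨ ω ∉ A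
    · have h1 := tail 1 le_rfl hM
      have h2 := hXadd 1 (M - 1) ω
      rw [Nat.add_sub_cancel' hM] at h2
      have h3 : ∑ k ∈ Finset.range M, φ (M - k) (T^[k] ω)
          = φ M ω + ∑ k ∈ Finset.Ico 1 M, φ (M - k) (T^[k] ω) := by
        rw [Finset.range_eq_Ico, Finset.sum_eq_sum_Ico_succ_bot hM]
        simp
      have h4 := hφ1 M ω hc
      have h5 := hf ω
      rw [h3]
      push_cast at h1
      linarith
    · push Not at hc
      obtain ⟨n, hn1, hnN, hn⟩ := hA ω hc.2
      have hnM : n ≤ M := by omega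
      have h1 := tail n hn1 hnM
      have h2 := hXadd n (M - n) ω
      rw [Nat.add_sub_cancel' hnM] at h2
      have h3 : ∑ k ∈ Finset.Ico n M, φ (M - k) (T^[k] ω)
          ≤ ∑ k ∈ Finset.range M, φ (M - k) (T^[k] ω) := by
        refine Finset.sum_le_sum_of_subset_of_nonneg (fun k hk => ?_) fun _ _ _ => hφ _ _
        simpa using (Finset.mem_Ico.1 hk).2
      linarith

/-- If a nonnegative subadditive process over a measure-preserving map almost surely takes, at some
positive time `n`, a value at most `n * f`, where `f` does not increase along trajectories, then
its mean rate of growth is at most the mean of `f`. -/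
lemma exists_integral_le_of_subadditive [MeasurableSpace Ω] {P : Measure Ω}
    [IsProbabilityMeasure P] {T : Ω → Ω} (hT : MeasurePreserving T P P) {X : ℕ → Ω → ℝ}
    {f : Ω → ℝ} (hXnn : ∀ n ω, 0 ≤ X n ω) (hX0 : ∀ ω, X 0 ω ≤ 0)
    (hXadd : ∀ m n ω, X (m + n) ω ≤ X m ω + X n (T^[m] ω))
    (hXm : ∀ n, Measurable (X n)) (hXi : ∀ n, Integrable (X n) P)
    (hf : ∀ ω, 0 ≤ f ω) (hfm : Measurable f) (hfi : Integrable f P) (hfT : ∀ ω, f (T ω) ≤ f ω)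
    (h : ∀ᵐ ω ∂P, ∃ n, 1 ≤ n ∧ X n ω ≤ n * f ω) {ε : ℝ} (hε : 0 < ε) :
    ∃ M : ℕ, 1 ≤ M ∧ ∫ ω, X M ω ∂P ≤ M * (∫ ω, f ω ∂P + ε) := by
  set A : ℕ → Set Ω := fun N => {ω | ∃ n, 1 ≤ n ∧ n ≤ N ∧ X n ω ≤ n * f ω} with hA
  have hAm : ∀ N, MeasurableSet (A N) := fun N => by
    have : A N = ⋃ n ∈ {n | 1 ≤ n ∧ n ≤ N}, {ω | X n ω ≤ n * f ω} := by
      ext ω; simp [hA, and_assoc]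
    rw [this]
    exact MeasurableSet.biUnion (to_countable _) fun n _ =>
      measurableSet_le (hXm n) (hfm.const_mul _)
  -- Almost every point has a cheap block of some length, so the cost of single steps taken outside
  -- `A N` vanishes in mean as `N` grows.
  have hlim : Tendsto (fun N => ∫ ω, (A N)ᶜ.indicator (X 1) ω ∂P) atTop (𝓝 (∫ _, (0 : ℝ) ∂P)) := by
    refine tendsto_integral_of_dominated_convergence (X 1)
      (fun N => ((hXm 1).indicator (hAm N).compl).aestronglyMeasurable) (hXi 1)
      (fun N => Eventually.of_forall fun ω => ?_) ?_
    · rw [Real.norm_of_nonneg (indicator_nonneg (fun ω _ => hXnn 1 ω) ω)]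
      exact indicator_le_self' (fun ω _ => hXnn 1 ω) ω
    · filter_upwards [h] with ω hω
      obtain ⟨n, hn1, hn⟩ := hω
      refine tendsto_const_nhds.congr' ?_
      filter_upwards [eventually_ge_atTop n] with N hN
      rw [indicator_of_notMem]
      simpa [hA] using ⟨n, hn1, hN, hn⟩
  rw [integral_zero] at hlim
  obtain ⟨N, hN⟩ := (hlim.eventually (gt_mem_nhds (half_pos hε))).exists
  -- The index `r` is the remaining time: the last `N` steps are charged in full, earlier ones only
  -- outside `A N`.
  set φ : ℕ → Ω → ℝ := fun r ω => if r ≤ N then X 1 ω else (A N)ᶜ.indicator (X 1) ω with hφ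
  have hφnn : ∀ r ω, 0 ≤ φ r ω := fun r ω => by
    simp only [hφ]
    split_ifs
    exacts [hXnn 1 ω, indicator_nonneg (fun ω _ => hXnn 1 ω) ω]
  have hφi : ∀ r, Integrable (φ r) P := fun r => by
    simp only [hφ]
    split_ifs
    exacts [hXi 1, (hXi 1).indicator (hAm N).compl]
  have hφint : ∀ r, ∫ ω, φ r ω ∂P ≤ ε / 2 + if r ≤ N then ∫ ω, X 1 ω ∂P else 0 := fun r => by
    simp only [hφ]
    split_ifs
    · linarith
    · simpa using hN.le
  have hTk : ∀ k, MeasurePreserving (T^[k]) P P := fun k => hT.iterate k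
  have hφTi : ∀ r k, Integrable (fun ω => φ r (T^[k] ω)) P := fun r k =>
    (hTk k).integrable_comp_of_integrable (hφi r)
  have hφT : ∀ r k, ∫ ω, φ r (T^[k] ω) ∂P = ∫ ω, φ r ω ∂P := fun r k => by
    have := hφi r
    rw [← (hTk k).map_eq] at this
    conv_rhs => rw [← (hTk k).map_eq]
    rw [integral_map (hTk k).measurable.aemeasurable this.aestronglyMeasurable]
  have hM : ∀ M : ℕ, ∫ ω, X M ω ∂P ≤ M * (∫ ω, f ω ∂P + ε / 2) + N * ∫ ω, X 1 ω ∂P := by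
    intro M
    have h1 := integral_mono (hXi M) ((hfi.const_mul (M : ℝ)).add
      (integrable_finsetSum (Finset.range M) fun k _ => hφTi (M - k) k))
      fun ω => by
        simpa using subadditive_tiling (φ := φ) (A := A N) (N := N) hX0 hXadd hf hfT
          (fun ω hω => hω) hφnn (fun r ω hr => by
            simp only [hφ]
            split_ifs with hrN
            · exact le_rfl
            · rw [indicator_of_mem]
              exact hr.resolve_left hrN) M ω
    simp only [Pi.add_apply] at h1
    rw [integral_add (hfi.const_mul (M : ℝ))
      (integrable_finsetSum (Finset.range M) fun k _ => hφTi (M - k) k),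
      integral_const_mul, integral_finsetSum _ fun k _ => hφTi (M - k) k] at h1
    simp only [hφT] at h1
    have h2 : ∑ k ∈ Finset.range M, ∫ ω, φ (M - k) ω ∂P
        ≤ M * (ε / 2) + N * ∫ ω, X 1 ω ∂P := by
      refine (Finset.sum_le_sum fun k _ => hφint (M - k)).trans ?_
      rw [Finset.sum_add_distrib, Finset.sum_const, Finset.card_range, nsmul_eq_mul,
        ← Finset.sum_filter, Finset.sum_const, nsmul_eq_mul]
      have hc : (Finset.filter (fun k => M - k ≤ N) (Finset.range M)).card ≤ N := by
        have : Finset.filter (fun k => M - k ≤ N) (Finset.range M) ⊆ Finset.Ico (M - N) M := by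
          intro k hk
          simp only [Finset.mem_filter, Finset.mem_range, Finset.mem_Ico] at hk ⊢
          omega
        refine (Finset.card_le_card this).trans ?_
        simp only [Nat.card_Ico]
        omega
      have hX1 : 0 ≤ ∫ ω, X 1 ω ∂P := integral_nonneg (hXnn 1)
      have : ((Finset.filter (fun k => M - k ≤ N) (Finset.range M)).card : ℝ) ≤ N := by
        exact_mod_cast hc
      nlinarith
    linarith
  -- The boundary cost `N * ∫ X 1` does not depend on `M`, so a large `M` absorbs it in the other
  -- half of `ε`.
  obtain ⟨M, hM1⟩ := exists_nat_gt ((N * ∫ ω, X 1 ω ∂P) / (ε / 2))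
  rw [div_lt_iff₀ (half_pos hε)] at hM1
  have hM0 : 1 ≤ M := by
    rcases Nat.eq_zero_or_pos M with rfl | h0
    · have : 0 ≤ N * ∫ ω, X 1 ω ∂P :=
        mul_nonneg (Nat.cast_nonneg N) (integral_nonneg (hXnn 1))
      simp at hM1
      linarith
    · exact h0
  exact ⟨M, hM0, (hM M).trans (by linarith)⟩

end Subadditive

/-! ### Moments of the speed bound from the exponential moment. -/

section Moments

variable {d : ℕ} {P : Measure (RMetric d)}

lemma cubeBound_zero_le (g : RMetric d) :
    cubeBound g 0 ≤ 1 + d * bigLambda g (unitCube 0) := by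
  refine csSup_le (Nonempty.image _ ⟨_, latticePoint_mem_unitCube 0⟩) ?_
  rintro _ ⟨x, hx, rfl⟩
  obtain ⟨K, hK⟩ := bddAbove_image_unitCube (continuous_speedBound g) 0
  have hb : BddAbove ((fun x => maxEigenvalue (g x)) '' unitCube (0 : Fin d → ℤ)) := by
    refine ⟨K, ?_⟩
    rintro _ ⟨y, hy, rfl⟩
    refine le_trans ?_ (hK (mem_image_of_mem _ hy))
    have := maxEigenvalue_le_trace (g y)
    unfold speedBound; linarith
  have h1 : maxEigenvalue (g x) ≤ bigLambda g (unitCube 0) := le_csSup hb (mem_image_of_mem _ hx)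
  have h2 := trace_le_mul_maxEigenvalue (g x)
  have h3 : (d : ℝ) * maxEigenvalue (g x) ≤ d * bigLambda g (unitCube 0) :=
    mul_le_mul_of_nonneg_left h1 (Nat.cast_nonneg d)
  unfold speedBound; linarith

/-- The trace is at most `d` times the maximum eigenvalue, hence the reduced rate `a / d`; the added
1 in the speed bound contributes the factor `exp (a / d)`. -/
lemma FiniteExpMoment.exists_cubeBound (hP : FiniteExpMoment P) (hd : 0 < d) :
    ∃ (a : ℝ) (F : RMetric d → ℝ), 0 < a ∧ Integrable F P ∧
      ∀ g, Real.exp (a * cubeBound g 0) ≤ F g := by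
  obtain ⟨a, ha, hint⟩ := hP
  have hd' : (0 : ℝ) < d := by exact_mod_cast hd
  refine ⟨a / d, _, by positivity, hint.const_mul (Real.exp (a / d)), fun g => ?_⟩
  rw [← Real.exp_add]
  refine Real.exp_le_exp.2 ((mul_le_mul_of_nonneg_left (cubeBound_zero_le g)
    (by positivity)).trans (le_of_eq ?_))
  field_simp

lemma FiniteExpMoment.exists_lintegral_le (hP : FiniteExpMoment P) (hd : 0 < d) :
    ∃ a b : ℝ, 0 < a ∧
      ∫⁻ g, ENNReal.ofReal (Real.exp (a * cubeBound g 0)) ∂P ≤ ENNReal.ofReal (Real.exp b) := by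
  obtain ⟨a, F, ha, hF, hle⟩ := hP.exists_cubeBound hd
  refine ⟨a, ∫ g, F g ∂P, ha, ?_⟩
  calc ∫⁻ g, ENNReal.ofReal (Real.exp (a * cubeBound g 0)) ∂P
      ≤ ∫⁻ g, ENNReal.ofReal (F g) ∂P := lintegral_mono fun g => ENNReal.ofReal_le_ofReal (hle g)
    _ = ENNReal.ofReal (∫ g, F g ∂P) := (ofReal_integral_eq_lintegral_ofReal hF
        (Eventually.of_forall fun g => (Real.exp_pos _).le.trans (hle g))).symm
    _ ≤ _ := ENNReal.ofReal_le_ofReal (by linarith [Real.add_one_le_exp (∫ g, F g ∂P)])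

lemma FiniteExpMoment.integrable_sq (hP : FiniteExpMoment P) (hd : 0 < d) :
    Integrable (fun g => speedBound g 0 ^ 2) P := by
  obtain ⟨a, F, ha, hF, hle⟩ := hP.exists_cubeBound hd
  refine Integrable.mono' (hF.const_mul (2 / a ^ 2))
    ((measurable_speedBound_comp (G := id) (measurable_apply 0)).pow_const 2).aestronglyMeasurable
    (Eventually.of_forall fun g => ?_)
  have h0 : (0 : EuclideanSpace ℝ (Fin d)) ∈ unitCube (0 : Fin d → ℤ) := fun i => by simp
  have h1 := speedBound_le_cubeBound g h0
  have h2 := speedBound_nonneg g 0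
  have h3 := Real.quadratic_le_exp_of_nonneg (mul_nonneg ha.le (cubeBound_nonneg g 0))
  have h4 := mul_nonneg ha.le (cubeBound_nonneg g 0)
  have h5 : a ^ 2 * cubeBound g 0 ^ 2 ≤ 2 * F g := by nlinarith [hle g]
  rw [Real.norm_of_nonneg (sq_nonneg _)]
  calc speedBound g 0 ^ 2 ≤ cubeBound g 0 ^ 2 := by gcongr
    _ ≤ 2 / a ^ 2 * F g := by
      rw [div_mul_eq_mul_div, le_div_iff₀ (by positivity)]
      linarith

end Moments

/-! ### Tail bounds for row sums and distance at large scales. -/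

section LargeDeviations

variable {d : ℕ} {P : Measure (RMetric d)}

lemma measurable_cubeBound (z : Fin d → ℤ) : Measurable fun g : RMetric d => cubeBound g z :=
  measurable_cubeBound_comp fun x _ => measurable_apply x

lemma measurable_ofReal_exp {Ω : Type*} [MeasurableSpace Ω] {f : Ω → ℝ} (hf : Measurable f)
    (a : ℝ) : Measurable fun ω => ENNReal.ofReal (Real.exp (a * f ω)) :=
  (Real.measurable_exp.comp (hf.const_mul a)).ennreal_ofReal

lemma measurable_ofReal_exp_sum {Ω : Type*} [MeasurableSpace Ω] {ι : Type*} {s : Finset ι}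
    {f : ι → Ω → ℝ} (hf : ∀ i ∈ s, Measurable (f i)) (a : ℝ) :
    Measurable fun ω => ENNReal.ofReal (Real.exp (a * ∑ i ∈ s, f i ω)) :=
  measurable_ofReal_exp (Finset.measurable_fun_sum s hf) a

lemma lintegral_exp_cubeBound (hP : TranslationInvariant P) (a : ℝ) (z : Fin d → ℤ) :
    ∫⁻ g, ENNReal.ofReal (Real.exp (a * cubeBound g z)) ∂P
      = ∫⁻ g, ENNReal.ofReal (Real.exp (a * cubeBound g 0)) ∂P := by
  have hm : Measurable fun g : RMetric d => ENNReal.ofReal (Real.exp (a * cubeBound g 0)) :=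
    measurable_ofReal_exp (measurable_cubeBound 0) a
  conv_rhs => rw [← (hP (latticePoint z)).map_eq]
  rw [lintegral_map hm (hP (latticePoint z)).measurable]
  simp [cubeBound_shift]

lemma abs_coord_sub_le_dist (x y : EuclideanSpace ℝ (Fin d)) (j : Fin d) :
    |x j - y j| ≤ dist x y := by
  rw [dist_eq_norm]
  simpa using PiLp.norm_apply_le (x - y) j

/-- Peel off the last cube: independence factors the expectation, and stationarity reduces each
factor to the cube at the origin. -/
lemma lintegral_exp_sum_le_of_indep [IsProbabilityMeasure P] (hP : TranslationInvariant P)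
    {a : ℝ} {M : ENNReal}
    (hM : ∫⁻ g, ENNReal.ofReal (Real.exp (a * cubeBound g 0)) ∂P ≤ M) (w : ℕ → Fin d → ℤ)
    (hw : ∀ k, Indep (sigmaOn (⋃ i ∈ Finset.range k, unitCube (w i)))
      (sigmaOn (unitCube (w k))) P) (k : ℕ) :
    ∫⁻ g, ENNReal.ofReal (Real.exp (a * ∑ i ∈ Finset.range k, cubeBound g (w i))) ∂P ≤ M ^ k := by
  induction k with
  | zero => simp
  | succ k ih =>
    set A : Set (EuclideanSpace ℝ (Fin d)) := ⋃ i ∈ Finset.range k, unitCube (w i) with hA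
    have hmA : Measurable[sigmaOn A] fun g : RMetric d =>
        ENNReal.ofReal (Real.exp (a * ∑ i ∈ Finset.range k, cubeBound g (w i))) :=
      @measurable_ofReal_exp_sum (RMetric d) (sigmaOn A) ℕ (Finset.range k)
        (fun i g => cubeBound g (w i)) (fun i hi => (measurable_cubeBound_sigmaOn (w i)).mono
          (sigmaOn_mono (subset_biUnion_of_mem (u := fun i : ℕ => unitCube (w i)) hi)) le_rfl) a
    have hmB : Measurable[sigmaOn (unitCube (w k))] fun g : RMetric d =>
        ENNReal.ofReal (Real.exp (a * cubeBound g (w k))) :=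
      @measurable_ofReal_exp (RMetric d) (sigmaOn (unitCube (w k))) (fun g => cubeBound g (w k))
        (measurable_cubeBound_sigmaOn (w k)) a
    have h1 := lintegral_mul_eq_lintegral_mul_lintegral_of_independent_measurableSpace
      (sigmaOn_le A) (sigmaOn_le _) (hw k) hmA hmB
    simp only [← ENNReal.ofReal_mul (Real.exp_pos _).le, ← Real.exp_add, ← mul_add] at h1
    simp only [Finset.sum_range_succ]
    rw [h1, pow_succ, lintegral_exp_cubeBound hP]
    exact mul_le_mul' ih hM

lemma lintegral_exp_sum_cubeBound_le [IsProbabilityMeasure P] (hP : TranslationInvariant P)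
    {R : ℝ} (hR : ∀ A B : Set (EuclideanSpace ℝ (Fin d)),
      (∀ x ∈ A, ∀ y ∈ B, R ≤ dist x y) → Indep (sigmaOn A) (sigmaOn B) P)
    {L : ℕ} (hL : R + 1 ≤ L) {a : ℝ} {M : ENNReal}
    (hM : ∫⁻ g, ENNReal.ofReal (Real.exp (a * cubeBound g 0)) ∂P ≤ M)
    (z : Fin d → ℤ) (j : Fin d) (k : ℕ) :
    ∫⁻ g, ENNReal.ofReal (Real.exp (a * ∑ i ∈ Finset.range k,
      cubeBound g (z + (i * L) • Pi.single j 1))) ∂P ≤ M ^ k := by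
  refine lintegral_exp_sum_le_of_indep hP hM (fun i : ℕ => z + (i * L) • Pi.single j 1)
    (fun k => hR _ _ fun x hx y hy => ?_) k
  obtain ⟨i, hi, hxi⟩ := mem_iUnion₂.1 hx
  have h1 := hxi j
  have h2 := hy j
  -- Centers differ by at least `L` in coordinate `j` and cubes have side 1, so the cubes are `L - 1
  -- ≥ R` apart.
  have h3 : ((i : ℝ) + 1) * L ≤ k * L := by
    refine mul_le_mul_of_nonneg_right ?_ (Nat.cast_nonneg L)
    exact_mod_cast Finset.mem_range.1 hi
  have e : ∀ n : ℕ, (((z + n • Pi.single j 1 : Fin d → ℤ) j : ℤ) : ℝ) = z j + n := by simp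
  rw [e, mem_Ico, Nat.cast_mul] at h1 h2
  refine le_trans ?_ (abs_coord_sub_le_dist x y j)
  rw [abs_sub_comm]
  refine le_trans ?_ (le_abs_self _)
  linarith [h1.1, h1.2, h2.1, h2.2]

lemma sum_range_mul_eq (f : ℕ → ℝ) (k L : ℕ) :
    ∑ i ∈ Finset.range (k * L), f i
      = ∑ r ∈ Finset.range L, ∑ i ∈ Finset.range k, f (r + i * L) := by
  induction k with
  | zero => simp
  | succ k ih =>
    rw [Nat.succ_mul, Finset.sum_range_add, ih, ← Finset.sum_add_distrib]
    simp only [Finset.sum_range_succ, add_comm]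

/-- Chernoff bound on each residue class modulo `L`, whose cubes are independent. The level `(b + 1)
/ a` beats the moment `exp (b * k)` by exactly `exp (-k)`; a large total forces some class to be
large. -/
lemma measure_rowSum_ge_le [IsProbabilityMeasure P] (hP : TranslationInvariant P)
    {R : ℝ} (hR : ∀ A B : Set (EuclideanSpace ℝ (Fin d)),
      (∀ x ∈ A, ∀ y ∈ B, R ≤ dist x y) → Indep (sigmaOn A) (sigmaOn B) P)
    {L : ℕ} (hL : R + 1 ≤ L) (hL0 : 0 < L) {a b : ℝ} (ha : 0 < a)
    (hM : ∫⁻ g, ENNReal.ofReal (Real.exp (a * cubeBound g 0)) ∂P ≤ ENNReal.ofReal (Real.exp b))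
    (z : Fin d → ℤ) (j : Fin d) (k : ℕ) :
    P {g | L * ((b + 1) / a * k) ≤ ∑ i ∈ Finset.range (k * L), cubeBound g (z + i • Pi.single j 1)}
      ≤ ENNReal.ofReal (L * Real.exp (-k)) := by
  have hrow : ∀ r : ℕ, P {g | (b + 1) / a * k ≤ ∑ i ∈ Finset.range k,
      cubeBound g (z + (r + i * L) • Pi.single j 1)} ≤ ENNReal.ofReal (Real.exp (-k)) := by
    intro r
    have h1 := lintegral_exp_sum_cubeBound_le hP hR hL hM (z + r • Pi.single j 1) j k
    simp only [add_assoc, ← add_smul] at h1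
    set S : RMetric d → ℝ := fun g =>
      ∑ i ∈ Finset.range k, cubeBound g (z + (r + i * L) • Pi.single j 1) with hS
    have hSm : Measurable S := Finset.measurable_fun_sum _ fun i _ => measurable_cubeBound _
    have h2 := mul_meas_ge_le_lintegral₀ (μ := P)
      (f := fun g => ENNReal.ofReal (Real.exp (a * S g)))
      (measurable_ofReal_exp hSm a).aemeasurable
      (ENNReal.ofReal (Real.exp ((b + 1) * k)))
    have h3 : {g | (b + 1) / a * k ≤ S g}
        ⊆ {g | ENNReal.ofReal (Real.exp ((b + 1) * k)) ≤ ENNReal.ofReal (Real.exp (a * S g))} := by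
      intro g hg
      refine ENNReal.ofReal_le_ofReal (Real.exp_le_exp.2 ?_)
      have := mul_le_mul_of_nonneg_left (show (b + 1) / a * k ≤ S g from hg) ha.le
      refine le_trans (le_of_eq ?_) this
      field_simp
    have h4 : ENNReal.ofReal (Real.exp ((b + 1) * k)) * P {g | (b + 1) / a * k ≤ S g}
        ≤ ENNReal.ofReal (Real.exp b) ^ k :=
      (mul_le_mul_right (measure_mono h3) _).trans (h2.trans h1)
    have h5 : ENNReal.ofReal (Real.exp b) ^ k
        = ENNReal.ofReal (Real.exp ((b + 1) * k)) * ENNReal.ofReal (Real.exp (-k)) := by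
      rw [← ENNReal.ofReal_pow (Real.exp_pos _).le, ← Real.exp_nat_mul,
        ← ENNReal.ofReal_mul (Real.exp_pos _).le, ← Real.exp_add]
      ring_nf
    rw [h5] at h4
    exact (ENNReal.mul_le_mul_iff_right (by simp [Real.exp_pos]) ENNReal.ofReal_ne_top).1 h4
  have hsub : {g : RMetric d | L * ((b + 1) / a * k)
      ≤ ∑ i ∈ Finset.range (k * L), cubeBound g (z + i • Pi.single j 1)}
      ⊆ ⋃ r ∈ Finset.range L, {g | (b + 1) / a * k ≤ ∑ i ∈ Finset.range k,
        cubeBound g (z + (r + i * L) • Pi.single j 1)} := by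
    intro g hg
    by_contra hcon
    simp only [mem_iUnion, mem_ofPred_eq, not_exists, not_le] at hcon
    rw [mem_ofPred_eq, sum_range_mul_eq] at hg
    have := Finset.sum_lt_sum_of_nonempty (Finset.nonempty_range_iff.2 hL0.ne') hcon
    rw [Finset.sum_const, Finset.card_range, nsmul_eq_mul] at this
    linarith
  refine (measure_mono hsub).trans ((measure_biUnion_finset_le _ _).trans ?_)
  refine (Finset.sum_le_sum fun r _ => hrow r).trans ?_
  rw [Finset.sum_const, Finset.card_range, nsmul_eq_mul, ENNReal.ofReal_mul (Nat.cast_nonneg L),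
    ENNReal.ofReal_natCast]

lemma summable_box_card_mul_exp (d H : ℕ) :
    Summable fun k : ℕ => ((2 * (k * H) + 1 : ℕ) : ℝ) ^ d * Real.exp (-k) := by
  have h1 := (summable_nat_add_iff 1).2 (Real.summable_pow_mul_exp_neg_nat_mul d one_pos)
  have h2 := h1.mul_left ((2 * H + 1 : ℝ) ^ d * Real.exp 1)
  refine Summable.of_nonneg_of_le (fun k => by positivity) (fun k => ?_) h2
  have h3 : ((2 * (k * H) + 1 : ℕ) : ℝ) ≤ (2 * H + 1) * (k + 1) := by
    push_cast
    nlinarith [(Nat.cast_nonneg k : (0 : ℝ) ≤ k), (Nat.cast_nonneg H : (0 : ℝ) ≤ H)]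
  calc ((2 * (k * H) + 1 : ℕ) : ℝ) ^ d * Real.exp (-k)
      ≤ ((2 * H + 1) * (k + 1)) ^ d * Real.exp (-k) := by gcongr
    _ = (2 * H + 1 : ℝ) ^ d * Real.exp 1 * (((k + 1 : ℕ) : ℝ) ^ d
          * Real.exp (-1 * ((k + 1 : ℕ) : ℝ))) := by
      rw [show (-(k : ℝ)) = 1 + (-1 * ((k + 1 : ℕ) : ℝ)) by push_cast; ring, Real.exp_add, mul_pow]
      push_cast
      ring

/-- Almost surely, all rows of length `k * L` in a box of size proportional to `k` have sums of
order `k`. -/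
lemma ae_eventually_rowBound [IsProbabilityMeasure P] (hP : TranslationInvariant P)
    {R : ℝ} (hR : ∀ A B : Set (EuclideanSpace ℝ (Fin d)),
      (∀ x ∈ A, ∀ y ∈ B, R ≤ dist x y) → Indep (sigmaOn A) (sigmaOn B) P)
    {L : ℕ} (hL : R + 1 ≤ L) (hL0 : 0 < L) {a b : ℝ} (ha : 0 < a)
    (hM : ∫⁻ g, ENNReal.ofReal (Real.exp (a * cubeBound g 0)) ∂P ≤ ENNReal.ofReal (Real.exp b))
    (H : ℕ) :
    ∀ᵐ g ∂P, ∀ᶠ k : ℕ in atTop, RowBound g (k * H) (k * L) (L * ((b + 1) / a * k)) := by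
  set box : ℕ → Finset (Fin d → ℤ) := fun k =>
    Fintype.piFinset fun _ => Finset.Icc (-(k * H : ℕ) : ℤ) (k * H : ℕ) with hbox
  set bad : ℕ → Set (RMetric d) := fun k => ⋃ z ∈ box k, ⋃ j ∈ (Finset.univ : Finset (Fin d)),
    {g | L * ((b + 1) / a * k)
      ≤ ∑ i ∈ Finset.range (k * L), cubeBound g (z + i • Pi.single j 1)} with hbad
  have hmeas : ∀ k, P (bad k) ≤ ENNReal.ofReal
      ((d * L) * (((2 * (k * H) + 1 : ℕ) : ℝ) ^ d * Real.exp (-k))) := by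
    intro k
    have hcard : ((box k).card : ℝ) = ((2 * (k * H) + 1 : ℕ) : ℝ) ^ d := by
      rw [hbox, Fintype.card_piFinset]
      simp only [Int.card_Icc, Finset.prod_const, Finset.card_univ, Fintype.card_fin]
      rw [show ((k * H : ℕ) : ℤ) + 1 - -((k * H : ℕ) : ℤ) = ((2 * (k * H) + 1 : ℕ) : ℤ) by
        push_cast; ring, Int.toNat_natCast]
      push_cast; rfl
    calc P (bad k) ≤ ∑ z ∈ box k, ∑ j : Fin d, ENNReal.ofReal (L * Real.exp (-k)) := by
          refine (measure_biUnion_finset_le _ _).trans (Finset.sum_le_sum fun z _ => ?_)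
          refine (measure_biUnion_finset_le _ _).trans (Finset.sum_le_sum fun j _ => ?_)
          exact measure_rowSum_ge_le hP hR hL hL0 ha hM z j k
      _ = ENNReal.ofReal ((box k).card * (d * (L * Real.exp (-k)))) := by
          rw [ENNReal.ofReal_mul (Nat.cast_nonneg _), ENNReal.ofReal_mul (Nat.cast_nonneg _)]
          simp
      _ = _ := by rw [hcard]; ring_nf
  have hsum : ∑' k, P (bad k) ≠ ⊤ := by
    refine ne_top_of_le_ne_top ?_ (ENNReal.tsum_le_tsum hmeas)
    exact ((summable_box_card_mul_exp d H).mul_left ((d : ℝ) * L)).tsum_ofReal_ne_top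
  filter_upwards [ae_eventually_notMem hsum] with g hg
  filter_upwards [hg] with k hk z hz j
  by_contra hcon
  refine hk (mem_iUnion₂.2 ⟨z, ?_, mem_iUnion₂.2 ⟨j, Finset.mem_univ j, not_lt.1 hcon⟩⟩)
  rw [hbox, Fintype.mem_piFinset]
  intro i
  rw [Finset.mem_Icc]
  exact abs_le.1 (hz i)

/-- Almost surely, at large scales `t`, points of the ball of radius `t` at Euclidean distance at
most `δ t` have Riemannian distance at most `C δ t`, where `C` does not depend on `δ`. -/
theorem exists_ae_riemDist_le [IsProbabilityMeasure P] (hd : 0 < d) (hP : TranslationInvariant P)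
    (hP_range : FiniteRangeDependence P) (hP_moment : FiniteExpMoment P) :
    ∃ C : ℝ, 0 < C ∧ ∀ δ : ℝ, 0 < δ → ∀ᵐ g ∂P, ∃ T : ℝ, 0 < T ∧ ∀ t, T ≤ t →
      ∀ x y : EuclideanSpace ℝ (Fin d), ‖x‖ ≤ t → ‖y‖ ≤ t → ‖y - x‖ ≤ δ * t →
        riemDist g x y ≤ C * (δ * t) := by
  obtain ⟨R, -, hR⟩ := hP_range
  obtain ⟨a, b₀, ha, hM₀⟩ := hP_moment.exists_lintegral_le hd
  -- Nonnegativity of `b` keeps the constant `C₀` positive.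
  set b := max b₀ 0
  have hM := hM₀.trans (ENNReal.ofReal_le_ofReal (Real.exp_le_exp.2 (le_max_left b₀ 0)))
  have hb : 0 ≤ b := le_max_right b₀ 0
  -- Besides separating cubes, `L ≥ 3` ensures `δ * t + 1 < k * L` for `k = ⌈δ * t⌉₊ ≥ 1`.
  obtain ⟨L, hL⟩ := exists_nat_ge (max (R + 1) 3)
  have hL1 : R + 1 ≤ L := (le_max_left _ _).trans hL
  have hL3 : (3 : ℝ) ≤ L := (le_max_right _ _).trans hL
  have hL0 : 0 < L := by
    have : (0 : ℝ) < L := by linarith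
    exact_mod_cast this
  have hd' : (0 : ℝ) < d := by exact_mod_cast hd
  have hLr : (0 : ℝ) < L := by exact_mod_cast hL0
  set C₀ : ℝ := 4 * d * (L * ((b + 1) / a)) with hC₀
  have hC₀pos : 0 < C₀ := by positivity
  refine ⟨2 * C₀, by positivity, fun δ hδ => ?_⟩
  -- Only the box size depends on `δ`: with this `H`, `k * H ≥ 2 * t`, so the box contains the ball
  -- of radius `t`. The constant in the row bound does not involve `H`.
  obtain ⟨H, hH⟩ := exists_nat_ge (2 / δ)
  filter_upwards [ae_eventually_rowBound hP hR hL1 hL0 ha hM H] with g hg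
  obtain ⟨K, hK⟩ := eventually_atTop.1 hg
  refine ⟨max 1 ((K + 1) / δ), by positivity, fun t ht x y hx hy hxy => ?_⟩
  have ht1 : 1 ≤ t := (le_max_left _ _).trans ht
  have hKt : (K : ℝ) + 1 ≤ δ * t := by
    have := (le_max_right _ _).trans ht
    rw [div_le_iff₀ hδ] at this
    linarith
  set k : ℕ := ⌈δ * t⌉₊ with hk
  have hk1 : δ * t ≤ k := Nat.le_ceil _
  have hk2 : (k : ℝ) < δ * t + 1 := Nat.ceil_lt_add_one (by positivity)
  have hKk : K ≤ k := by
    have : (K : ℝ) ≤ k := by linarith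
    exact_mod_cast this
  have hK0 : (0 : ℝ) ≤ K := Nat.cast_nonneg K
  have hkpos : 0 < k := by
    have : (0 : ℝ) < k := by linarith
    exact_mod_cast this
  have hkr : (1 : ℝ) ≤ k := by exact_mod_cast hkpos
  have hbox : t + 1 / 2 ≤ ((k * H : ℕ) : ℝ) := by
    have : 2 * t ≤ k * H := by
      calc 2 * t = δ * t * (2 / δ) := by field_simp
        _ ≤ k * H := mul_le_mul hk1 hH (by positivity) (Nat.cast_nonneg k)
    push_cast
    linarith
  have hcoord : ∀ (u : EuclideanSpace ℝ (Fin d)) i, |u i| ≤ ‖u‖ := fun u i => by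
    simpa using PiLp.norm_apply_le u i
  have hfin := (hK k hKk).riemDist_le ⟨0, hd⟩ (Nat.mul_pos hkpos hL0) (x := x) (y := y)
    (fun i => by linarith [hcoord x i]) (fun i => by linarith [hcoord y i])
    (fun i => by
      have h1 := hcoord (y - x) i
      rw [PiLp.sub_apply] at h1
      push_cast
      nlinarith)
  calc riemDist g x y ≤ C₀ * k := by rw [hC₀]; linarith
    _ ≤ C₀ * (2 * (δ * t)) := by
      refine mul_le_mul_of_nonneg_left ?_ hC₀pos.le
      linarith
    _ = 2 * C₀ * (δ * t) := by ring

end LargeDeviations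

/-! ### The time constant and the limit along integers. -/

section TimeConstant

variable {d : ℕ} {P : Measure (RMetric d)}

/-- The infimum of the normalized mean distances in direction `v`. -/
noncomputable def timeConstant (P : Measure (RMetric d)) (v : EuclideanSpace ℝ (Fin d)) : ℝ :=
  ⨅ n : ℕ, (∫ g, riemDist g 0 (((n + 1 : ℕ) : ℝ) • v) ∂P) / (n + 1 : ℕ)

lemma timeConstant_nonneg (P : Measure (RMetric d)) (v : EuclideanSpace ℝ (Fin d)) :
    0 ≤ timeConstant P v :=
  Real.iInf_nonneg fun _ => div_nonneg (integral_nonneg fun g => riemDist_nonneg g _ _)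
    (Nat.cast_nonneg _)

lemma mul_timeConstant_le (P : Measure (RMetric d)) (v : EuclideanSpace ℝ (Fin d)) {n : ℕ}
    (hn : 1 ≤ n) : n * timeConstant P v ≤ ∫ g, riemDist g 0 ((n : ℝ) • v) ∂P := by
  obtain ⟨m, rfl⟩ := Nat.exists_eq_add_of_le' hn
  have h : timeConstant P v
      ≤ (∫ g, riemDist g 0 (((m + 1 : ℕ) : ℝ) • v) ∂P) / (m + 1 : ℕ) := by
    refine ciInf_le ⟨0, ?_⟩ m
    rintro _ ⟨n, rfl⟩
    exact div_nonneg (integral_nonneg fun g => riemDist_nonneg g _ _) (Nat.cast_nonneg _)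
  rw [le_div_iff₀ (by positivity)] at h
  linarith

lemma exists_integral_riemDist_le (P : Measure (RMetric d)) (v : EuclideanSpace ℝ (Fin d))
    {ε : ℝ} (hε : 0 < ε) : ∃ n : ℕ, 1 ≤ n ∧
      ∫ g, riemDist g 0 ((n : ℝ) • v) ∂P ≤ n * (timeConstant P v + ε) := by
  obtain ⟨n, hn⟩ := exists_lt_of_ciInf_lt (lt_add_of_pos_right (timeConstant P v) hε)
  refine ⟨n + 1, by omega, ?_⟩
  rw [div_lt_iff₀ (by positivity)] at hn
  linarith

lemma iterate_shift (v : EuclideanSpace ℝ (Fin d)) (m : ℕ) (g : RMetric d) :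
    (shift v)^[m] g = shift ((m : ℝ) • v) g := by
  induction m generalizing g with
  | zero => ext1 x; simp
  | succ m ih =>
    rw [Function.iterate_succ_apply, ih]
    ext1 x
    simp [add_smul, add_assoc]

lemma identDistrib_comp_shift (hP : TranslationInvariant P) {Y : RMetric d → ℝ}
    (hY : Measurable Y) (x y : EuclideanSpace ℝ (Fin d)) :
    IdentDistrib (fun g => Y (shift x g)) (fun g => Y (shift y g)) P P := by
  refine ⟨(hY.comp (hP x).measurable).aemeasurable, (hY.comp (hP y).measurable).aemeasurable, ?_⟩
  change P.map (Y ∘ shift x) = P.map (Y ∘ shift y)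
  rw [← Measure.map_map hY (hP x).measurable, ← Measure.map_map hY (hP y).measurable,
    (hP x).map_eq, (hP y).map_eq]

lemma integral_comp_shift (hP : TranslationInvariant P) {Y : RMetric d → ℝ}
    (hY : Measurable Y) (x : EuclideanSpace ℝ (Fin d)) :
    ∫ g, Y (shift x g) ∂P = ∫ g, Y g ∂P := by
  conv_rhs => rw [← (hP x).map_eq]
  rw [integral_map (hP x).measurable.aemeasurable hY.aestronglyMeasurable]

/-- The two variables see only balls of radius `K` about `x` and `y`, which are at least `R` apart.
-/
lemma indepFun_comp_shift {R : ℝ} (hR : ∀ A B : Set (EuclideanSpace ℝ (Fin d)),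
      (∀ x ∈ A, ∀ y ∈ B, R ≤ dist x y) → Indep (sigmaOn A) (sigmaOn B) P)
    {Y : RMetric d → ℝ} {K : ℝ} (hY : Measurable[sigmaOn (Metric.closedBall 0 K)] Y)
    {x y : EuclideanSpace ℝ (Fin d)} (hxy : R + 2 * K ≤ dist x y) :
    IndepFun (fun g => Y (shift x g)) (fun g => Y (shift y g)) P := by
  have hle : ∀ z, MeasurableSpace.comap (fun g => Y (shift z g)) inferInstance
      ≤ sigmaOn ((· + z) '' Metric.closedBall (0 : EuclideanSpace ℝ (Fin d)) K) := fun z =>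
    measurable_iff_comap_le.1 (hY.comp (measurable_shift_sigmaOn z _))
  rw [IndepFun_iff_Indep]
  refine indep_of_indep_of_le_left (indep_of_indep_of_le_right (hR _ _ ?_) (hle y)) (hle x)
  rintro _ ⟨a, ha, rfl⟩ _ ⟨b, hb, rfl⟩
  rw [mem_closedBall_zero_iff] at ha hb
  rw [dist_eq_norm] at hxy ⊢
  have h1 : ‖x - y‖ ≤ ‖a + x - (b + y)‖ + (‖a‖ + ‖b‖) := by
    calc ‖x - y‖ = ‖(a + x - (b + y)) - (a - b)‖ := by congr 1; abel
      _ ≤ ‖a + x - (b + y)‖ + ‖a - b‖ := norm_sub_le _ _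
      _ ≤ _ := by gcongr; exact norm_sub_le _ _
  linarith

lemma riemDist_le_sum_shift (g : RMetric d) (u : EuclideanSpace ℝ (Fin d)) (k : ℕ) :
    riemDist g 0 ((k : ℝ) • u)
      ≤ ∑ i ∈ Finset.range k, riemDist (shift ((i : ℝ) • u) g) 0 u := by
  induction k with
  | zero => simp [riemDist_self]
  | succ k ih =>
    rw [Finset.sum_range_succ, riemDist_shift, zero_add]
    have := riemDist_triangle g 0 ((k : ℝ) • u) (((k + 1 : ℕ) : ℝ) • u)
    rw [show u + (k : ℝ) • u = ((k + 1 : ℕ) : ℝ) • u by push_cast; rw [add_smul, one_smul, add_comm]]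
    linarith

variable [IsProbabilityMeasure P]

/-- Along the multiples of some integer, the normalized distance is eventually below any bound
larger than the time constant. -/
lemma exists_ae_eventually_riemDist_le (hP : TranslationInvariant P)
    (hP_range : FiniteRangeDependence P) (h2 : Integrable (fun g => speedBound g 0 ^ 2) P)
    {v : EuclideanSpace ℝ (Fin d)} (hv : ‖v‖ = 1) {ε : ℝ} (hε : 0 < ε) :
    ∃ p : ℕ, 1 ≤ p ∧ ∀ᵐ g ∂P, ∀ᶠ n : ℕ in atTop,
      riemDist g 0 (((n * p : ℕ) : ℝ) • v) ≤ (n * p : ℕ) * (timeConstant P v + ε) := by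
  obtain ⟨R, -, hR⟩ := hP_range
  obtain ⟨m, hm, hEm⟩ := exists_integral_riemDist_le P v (show 0 < ε / 4 by linarith)
  have hm1 : (1 : ℝ) ≤ m := by exact_mod_cast hm
  set u : EuclideanSpace ℝ (Fin d) := (m : ℝ) • v with hu
  obtain ⟨Y, K, hYm, hYle, hYi, hEY⟩ :=
    exists_local_upper_bound hP h2 0 u (show 0 < ε / 4 by linarith)
  have hYm' : Measurable Y := hYm.mono (sigmaOn_le _) le_rfl
  obtain ⟨L, hL⟩ := exists_nat_ge (max (R + 2 * K) 1)
  have hL1 : (1 : ℝ) ≤ L := (le_max_right _ _).trans hL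
  have hLR : R + 2 * K ≤ L := (le_max_left _ _).trans hL
  have hLpos : 1 ≤ L := by exact_mod_cast hL1
  -- Within a residue class modulo `L` the translates are at least `L * m ≥ R + 2 * K` apart, hence
  -- pairwise independent and identically distributed, which is all the strong law needs.
  have hslln : ∀ r : ℕ, ∀ᵐ g ∂P, Tendsto (fun n : ℕ =>
      (∑ i ∈ Finset.range n, Y (shift (((r + i * L : ℕ) : ℝ) • u) g)) / n) atTop
      (𝓝 (∫ g, Y g ∂P)) := by
    intro r
    have := strong_law_ae_real (μ := P)
      (fun (i : ℕ) g => Y (shift (((r + i * L : ℕ) : ℝ) • u) g))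
      ((hP _).integrable_comp_of_integrable hYi) (fun i j hij => ?_)
      (fun i => identDistrib_comp_shift hP hYm' _ _)
    · rwa [integral_comp_shift hP hYm'] at this
    · refine indepFun_comp_shift hR hYm (hLR.trans ?_)
      rw [dist_eq_norm, ← sub_smul, hu, norm_smul, norm_smul, hv, mul_one, Real.norm_eq_abs,
        Real.norm_of_nonneg (Nat.cast_nonneg m)]
      have h1 : (1 : ℝ) ≤ |(i : ℝ) - j| := by
        have : (1 : ℤ) ≤ |(i : ℤ) - j| := Int.one_le_abs (sub_ne_zero.2 (by exact_mod_cast hij))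
        exact_mod_cast this
      have h3 : |((r + i * L : ℕ) : ℝ) - ((r + j * L : ℕ) : ℝ)| = |(i : ℝ) - j| * L := by
        rw [show ((r + i * L : ℕ) : ℝ) - ((r + j * L : ℕ) : ℝ) = ((i : ℝ) - j) * L by
          push_cast; ring, abs_mul, abs_of_nonneg (Nat.cast_nonneg (α := ℝ) L)]
      rw [h3]
      have h4 : (L : ℝ) ≤ |(i : ℝ) - j| * L := le_mul_of_one_le_left (by linarith) h1
      exact h4.trans (le_mul_of_one_le_right (by linarith) hm1)
  refine ⟨L * m, Nat.mul_pos hLpos hm, ?_⟩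
  filter_upwards [ae_all_iff.2 hslln] with g hg
  have hev : ∀ᶠ n : ℕ in atTop, ∀ r ∈ Finset.range L,
      (∑ i ∈ Finset.range n, Y (shift (((r + i * L : ℕ) : ℝ) • u) g)) / n
        < ∫ g, Y g ∂P + ε / 4 :=
    (Finset.eventually_all _).2 fun r _ =>
      (hg r).eventually (gt_mem_nhds (lt_add_of_pos_right _ (by linarith)))
  filter_upwards [hev, eventually_ge_atTop 1] with n hn hn1
  have hnr : (0 : ℝ) < n := by exact_mod_cast hn1
  have h3 : riemDist g 0 (((n * L : ℕ) : ℝ) • u)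
      ≤ ∑ i ∈ Finset.range (n * L), Y (shift ((i : ℝ) • u) g) :=
    (riemDist_le_sum_shift g u (n * L)).trans (Finset.sum_le_sum fun i _ => hYle _)
  rw [sum_range_mul_eq] at h3
  have h4 : ∑ r ∈ Finset.range L, ∑ i ∈ Finset.range n, Y (shift (((r + i * L : ℕ) : ℝ) • u) g)
      ≤ ∑ r ∈ Finset.range L, (∫ g, Y g ∂P + ε / 4) * n :=
    Finset.sum_le_sum fun r hr => by
      have := hn r hr
      rw [div_lt_iff₀ hnr] at this
      exact this.le
  rw [Finset.sum_const, Finset.card_range, nsmul_eq_mul] at h4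
  have h5 : ((n * (L * m) : ℕ) : ℝ) • v = ((n * L : ℕ) : ℝ) • u := by
    rw [hu, smul_smul]; push_cast; ring_nf
  have h6 : ∫ g, Y g ∂P + ε / 4 ≤ m * (timeConstant P v + ε) := by nlinarith
  rw [h5]
  refine h3.trans (h4.trans ?_)
  push_cast
  calc (L : ℝ) * ((∫ g, Y g ∂P + ε / 4) * n)
      ≤ L * ((m * (timeConstant P v + ε)) * n) := by gcongr
    _ = n * (L * m) * (timeConstant P v + ε) := by ring

/-- Metrics whose normalized distance in direction `v` has lower limit at most `c`. -/
def liminfLeSet (v : EuclideanSpace ℝ (Fin d)) (c : ℝ) : Set (RMetric d) :=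
  {g | ∀ k : ℕ, ∃ᶠ n : ℕ in atTop, riemDist g 0 ((n : ℝ) • v) ≤ (c + 1 / (k + 1)) * n}

lemma measurableSet_liminfLeSet (v : EuclideanSpace ℝ (Fin d)) (c : ℝ) :
    MeasurableSet (liminfLeSet v c) := by
  have : liminfLeSet v c = ⋂ k : ℕ, ⋂ N : ℕ, ⋃ n ∈ Ici N,
      {g | riemDist g 0 ((n : ℝ) • v) ≤ (c + 1 / (k + 1)) * n} := by
    ext g
    simp [liminfLeSet, frequently_atTop]
  rw [this]
  exact MeasurableSet.iInter fun k => MeasurableSet.iInter fun N =>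
    MeasurableSet.biUnion (to_countable _) fun n _ =>
      measurableSet_le (measurable_riemDist _ _) measurable_const

lemma shift_mem_liminfLeSet {v : EuclideanSpace ℝ (Fin d)} {c : ℝ} {g : RMetric d}
    (hg : g ∈ liminfLeSet v c) : shift v g ∈ liminfLeSet v c := by
  intro k
  set D : ℝ := riemDist g v 0 + |c + 1 / (k + 1)| with hD
  -- This index halves the slack `1 / (k + 1)`. For large `n` the other half absorbs `D`, the cost
  -- of moving the starting point and losing one unit of time.
  set k' : ℕ := 2 * k + 1 with hk'
  have hkr : (0 : ℝ) < k + 1 := by positivity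
  have hk2 : (1 : ℝ) / (k' + 1) = 1 / (k + 1) / 2 := by
    rw [hk', div_div]; push_cast; ring_nf
  rw [frequently_atTop]
  intro N
  obtain ⟨N', hN'⟩ := exists_nat_ge (2 * (k + 1) * D)
  obtain ⟨n, hn, hle⟩ := frequently_atTop.1 (hg k') (max (N + 1) N')
  have hn1 : N + 1 ≤ n := (le_max_left _ _).trans hn
  have hn2 : (N' : ℝ) ≤ n := by exact_mod_cast (le_max_right _ _).trans hn
  obtain ⟨m, rfl⟩ := Nat.exists_eq_add_of_le' (show 1 ≤ n by omega)
  refine ⟨m, by omega, ?_⟩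
  rw [riemDist_shift, zero_add,
    show (m : ℝ) • v + v = ((m + 1 : ℕ) : ℝ) • v by push_cast; rw [add_smul, one_smul]]
  have h1 := riemDist_triangle g v 0 (((m + 1 : ℕ) : ℝ) • v)
  rw [hk2] at hle
  have h3 : D ≤ 1 / (k + 1) / 2 * ((m + 1 : ℕ) : ℝ) := by
    rw [div_div, div_mul_eq_mul_div, one_mul, le_div_iff₀ (by positivity)]
    linarith
  have h4 := le_abs_self (c + 1 / ((k : ℝ) + 1))
  push_cast at *
  nlinarith

lemma measure_liminfLeSet_eq_zero (hP : TranslationInvariant P)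
    (hP_range : FiniteRangeDependence P) (h2 : Integrable (fun g => speedBound g 0 ^ 2) P)
    {v : EuclideanSpace ℝ (Fin d)} (hv : ‖v‖ = 1) {c : ℝ} (hc0 : 0 ≤ c)
    (hc : c < timeConstant P v) : P (liminfLeSet v c) = 0 := by
  set B := liminfLeSet v c with hB
  set m := timeConstant P v with hm
  have hBm : MeasurableSet B := measurableSet_liminfLeSet v c
  have hmc : 0 < m - c := sub_pos.2 hc
  have key : ∀ ε : ℝ, 0 < ε → (m - c) * P.real B ≤ 2 * ε := by
    intro ε hε
    -- The target rate is `c + ε` on `B` and `m + ε` off it. It cannot increase under the shift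
    -- because `B` is mapped into itself, and it is nonnegative because `c` is.
    set f : RMetric d → ℝ := fun g => m + ε - B.indicator (fun _ => m - c) g with hf
    have hind : Integrable (B.indicator fun _ : RMetric d => m - c) P :=
      (integrable_const _).indicator hBm
    have hfi : Integrable f P := (integrable_const _).sub hind
    have hfint : ∫ g, f g ∂P = m + ε - P.real B * (m - c) := by
      rw [hf, integral_sub (integrable_const _) hind, integral_indicator_const _ hBm]
      simp
    obtain ⟨p, hp, hup⟩ := exists_ae_eventually_riemDist_le hP hP_range h2 hv hε
    obtain ⟨M, hM1, hM⟩ := exists_integral_le_of_subadditive (P := P) (hP v)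
      (X := fun n g => riemDist g 0 ((n : ℝ) • v)) (f := f)
      (fun n g => riemDist_nonneg g _ _) (fun g => by simp [riemDist_self])
      (fun m n g => by
        rw [iterate_shift, riemDist_shift, zero_add, ← add_smul, add_comm (n : ℝ), ← Nat.cast_add]
        exact riemDist_triangle g _ _ _)
      (fun n => measurable_riemDist _ _) (fun n => integrable_riemDist hP h2 _ _)
      (fun g => by
        have : B.indicator (fun _ => m - c) g ≤ m - c :=
          indicator_apply_le' (fun _ => le_rfl) fun _ => hmc.le
        simp only [hf]; linarith)
      (measurable_const.sub (measurable_const.indicator hBm)) hfi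
      (fun g => by
        by_cases hg : g ∈ B
        · have hs : shift v g ∈ B := shift_mem_liminfLeSet hg
          simp only [hf, indicator_of_mem hg, indicator_of_mem hs, le_rfl]
        · have : 0 ≤ B.indicator (fun _ => m - c) (shift v g) :=
            indicator_nonneg (fun _ _ => hmc.le) _
          simp only [hf, indicator_of_notMem hg]; linarith)
      (by
        filter_upwards [hup] with g hg
        -- On `B` a cheap time exists by definition of the lower limit; off `B` the strong-law upper
        -- bound supplies one.
        by_cases hgB : g ∈ B
        · obtain ⟨k, hk⟩ := exists_nat_one_div_lt hε
          obtain ⟨n, hn1, hn⟩ := frequently_atTop.1 (hgB k) 1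
          refine ⟨n, hn1, hn.trans ?_⟩
          simp only [hf, indicator_of_mem hgB]
          have : (0 : ℝ) ≤ n := Nat.cast_nonneg n
          nlinarith
        · obtain ⟨n, hn, hn1⟩ := (hg.and (eventually_ge_atTop 1)).exists
          refine ⟨n * p, Nat.mul_pos hn1 hp, hn.trans (le_of_eq ?_)⟩
          simp [hf, indicator_of_notMem hgB, hm]) hε
    have h3 := (mul_timeConstant_le P v hM1).trans hM
    have h4 : m ≤ ∫ g, f g ∂P + ε := le_of_mul_le_mul_left h3 (by exact_mod_cast hM1)
    rw [hfint] at h4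
    linarith
  have h0 : (m - c) * P.real B ≤ 0 := le_of_forall_pos_le_add fun ε hε => by
    have := key (ε / 2) (by linarith)
    linarith
  have h1 : P.real B = 0 := le_antisymm (nonpos_of_mul_nonpos_right h0 hmc) measureReal_nonneg
  exact (measureReal_eq_zero_iff).1 h1

lemma ae_eventually_le_riemDist (hP : TranslationInvariant P)
    (hP_range : FiniteRangeDependence P) (h2 : Integrable (fun g => speedBound g 0 ^ 2) P)
    {v : EuclideanSpace ℝ (Fin d)} (hv : ‖v‖ = 1) {c : ℝ} (hc : c < timeConstant P v) :
    ∀ᵐ g ∂P, ∀ᶠ n : ℕ in atTop, c * n ≤ riemDist g 0 ((n : ℝ) • v) := by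
  rcases lt_or_ge c 0 with h | h
  · refine Eventually.of_forall fun g => Eventually.of_forall fun n => ?_
    have := riemDist_nonneg g 0 ((n : ℝ) • v)
    have : (0 : ℝ) ≤ n := Nat.cast_nonneg n
    nlinarith
  · have h0 := measure_eq_zero_iff_ae_notMem.1
      (measure_liminfLeSet_eq_zero hP hP_range h2 hv h hc)
    filter_upwards [h0] with g hg
    simp only [liminfLeSet, mem_ofPred_eq, not_forall, not_frequently, not_le] at hg
    obtain ⟨k, hk⟩ := hg
    filter_upwards [hk] with n hn
    refine le_trans ?_ hn.le
    exact mul_le_mul_of_nonneg_right (le_add_of_nonneg_right (by positivity)) (Nat.cast_nonneg n)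

end TimeConstant

/-! ### Convergence along real times, in mean, and uniformly in direction. -/

section Convergence

variable {d : ℕ} {P : Measure (RMetric d)} [IsProbabilityMeasure P]

lemma ae_eventually_abs_sub_timeConstant_le (hd : 0 < d) (hP : TranslationInvariant P)
    (hP_range : FiniteRangeDependence P) (hP_moment : FiniteExpMoment P)
    {v : EuclideanSpace ℝ (Fin d)} (hv : ‖v‖ = 1) {ε : ℝ} (hε : 0 < ε) :
    ∀ᵐ g ∂P, ∀ᶠ t : ℝ in atTop, |riemDist g 0 (t • v) / t - timeConstant P v| ≤ ε := by
  have h2 := hP_moment.integrable_sq hd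
  obtain ⟨C, hC, hKB⟩ := exists_ae_riemDist_le hd hP hP_range hP_moment
  obtain ⟨p, hp, hup⟩ := exists_ae_eventually_riemDist_le hP hP_range h2 hv (half_pos hε)
  set m := timeConstant P v with hm
  have hm0 : 0 ≤ m := timeConstant_nonneg P v
  have hlow := ae_eventually_le_riemDist hP hP_range h2 hv
    (show m - ε / 2 < timeConstant P v by linarith)
  -- With this `δ`, replacing `t` by a nearby grid time costs at most `ε / 4 * t`.
  set δ : ℝ := ε / (4 * C) with hδ
  have hδ0 : 0 < δ := by positivity
  have hCδ : ∀ t : ℝ, C * (δ * t) = ε / 4 * t := fun t => by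
    rw [hδ]; field_simp
  filter_upwards [hKB δ hδ0, hup, hlow] with g hg hgu hgl
  obtain ⟨T, hT, hg⟩ := hg
  obtain ⟨N₁, hN₁⟩ := eventually_atTop.1 hgu
  obtain ⟨N₂, hN₂⟩ := eventually_atTop.1 hgl
  have hpr : (1 : ℝ) ≤ p := by exact_mod_cast hp
  have near : ∀ s t : ℝ, T ≤ t → 0 ≤ s → s ≤ t → t - s ≤ δ * t →
      riemDist g (s • v) (t • v) ≤ ε / 4 * t := by
    intro s t ht hs hst hts
    rw [← hCδ]
    refine hg t ht _ _ ?_ ?_ ?_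
    · rw [norm_smul, hv, mul_one, Real.norm_of_nonneg hs]; exact hst
    · rw [norm_smul, hv, mul_one, Real.norm_of_nonneg (hs.trans hst)]
    · rw [← sub_smul, norm_smul, hv, mul_one, Real.norm_of_nonneg (sub_nonneg.2 hst)]; exact hts
  -- `p / δ` bounds the gap to the previous multiple of `p` by `δ * t`; `N₁ * p` and `N₂` activate
  -- the estimates on the grid; the last threshold absorbs the rounding of `t` in the lower bound,
  -- where `m - ε / 2` may be negative.
  filter_upwards [eventually_ge_atTop T, eventually_ge_atTop (p / δ : ℝ),
    eventually_ge_atTop (N₁ * p : ℝ), eventually_ge_atTop (N₂ : ℝ),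
    eventually_ge_atTop (4 * |m - ε / 2| / ε)] with t h1 h3 h4 h5 h6
  have ht : 0 < t := hT.trans_le h1
  rw [div_le_iff₀ hδ0] at h3
  rw [div_le_iff₀ hε] at h6
  have hp0 : (0 : ℝ) < p := by linarith
  have upper : riemDist g 0 (t • v) ≤ (m + ε) * t := by
    set n := ⌊t / p⌋₊ with hn
    have hn1 : (n : ℝ) * p ≤ t := (le_div_iff₀ hp0).1 (Nat.floor_le (by positivity))
    have hn2 : t < (n + 1) * p := (div_lt_iff₀ hp0).1 (Nat.lt_floor_add_one _)
    have hn3 : N₁ ≤ n := Nat.le_floor ((le_div_iff₀ hp0).2 h4)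
    have h7 := hN₁ n hn3
    have h8 := near (n * p) t h1 (by positivity) hn1 (by linarith)
    have h9 := riemDist_triangle g 0 (((n : ℝ) * p) • v) (t • v)
    push_cast at h7
    have : (n : ℝ) * p * (m + ε / 2) ≤ t * (m + ε / 2) :=
      mul_le_mul_of_nonneg_right hn1 (by linarith)
    nlinarith
  have lower : (m - ε) * t ≤ riemDist g 0 (t • v) := by
    set n := ⌊t⌋₊ with hn
    have hn1 : (n : ℝ) ≤ t := Nat.floor_le ht.le
    have hn2 : t < n + 1 := Nat.lt_floor_add_one _
    have hn3 : N₂ ≤ n := Nat.le_floor h5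
    have h7 := hN₂ n hn3
    have h8 := near n t h1 (Nat.cast_nonneg n) hn1 (by linarith)
    rw [riemDist_comm] at h8
    have h9 := riemDist_triangle g 0 (t • v) ((n : ℝ) • v)
    have h10 : (m - ε / 2) * (t - n) ≤ |m - ε / 2| := by
      refine (le_abs_self _).trans ?_
      rw [abs_mul]
      refine mul_le_of_le_one_right (abs_nonneg _) ?_
      rw [abs_le]; constructor <;> linarith
    nlinarith
  rw [div_sub' ht.ne', abs_div, abs_of_pos ht, div_le_iff₀ ht, abs_le]
  constructor <;> linarith

lemma ae_tendsto_riemDist_div (hd : 0 < d) (hP : TranslationInvariant P)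
    (hP_range : FiniteRangeDependence P) (hP_moment : FiniteExpMoment P)
    {v : EuclideanSpace ℝ (Fin d)} (hv : ‖v‖ = 1) :
    ∀ᵐ g ∂P, Tendsto (fun t : ℝ => riemDist g 0 (t • v) / t) atTop (𝓝 (timeConstant P v)) := by
  have h : ∀ᵐ g ∂P, ∀ k : ℕ, ∀ᶠ t : ℝ in atTop,
      |riemDist g 0 (t • v) / t - timeConstant P v| ≤ 1 / (k + 1) :=
    ae_all_iff.2 fun k => ae_eventually_abs_sub_timeConstant_le hd hP hP_range hP_moment hv
      (by positivity)
  filter_upwards [h] with g hg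
  refine Metric.tendsto_nhds.2 fun ε hε => ?_
  obtain ⟨k, hk⟩ := exists_nat_one_div_lt hε
  filter_upwards [hg k] with t ht
  exact ht.trans_lt hk

/-- Integrate `q ≤ K + q ^ 2 / K` along the segment. The mean of the second term is of order `1 / K`
uniformly in `t`, which serves as uniform integrability. -/
lemma riemDist_div_le (g : RMetric d) {v : EuclideanSpace ℝ (Fin d)} (hv : ‖v‖ = 1) {t K : ℝ}
    (ht : 0 < t) (hK : 0 < K) :
    riemDist g 0 (t • v) / t ≤ K + squareAverage g (fun s => s • t • v) / K := by
  have hc : Continuous fun s : ℝ => s • t • v := by fun_prop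
  have h := riemDist_le_integral_speedBound g 0 (t • v)
  simp only [sub_zero, zero_add] at h
  rw [norm_smul, hv, mul_one, Real.norm_of_nonneg ht.le] at h
  rw [div_le_iff₀ ht, mul_comm]
  refine h.trans (mul_le_mul_of_nonneg_left ?_ ht.le)
  have hq : ∀ q : ℝ, q ≤ K + q ^ 2 / K := fun q => by
    rw [← sub_le_iff_le_add', le_div_iff₀ hK]
    nlinarith [sq_nonneg (q - K), sq_nonneg q, sq_nonneg K]
  have hci := (continuous_speedBound g).comp hc
  have hi : IntervalIntegrable (fun s : ℝ => speedBound g (s • t • v) ^ 2 / K) volume 0 1 :=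
    ((hci.pow 2).div_const K).intervalIntegrable _ _
  calc ∫ s in (0 : ℝ)..1, speedBound g (s • t • v)
      ≤ ∫ s in (0 : ℝ)..1, (K + speedBound g (s • t • v) ^ 2 / K) :=
        intervalIntegral.integral_mono_on zero_le_one (hci.intervalIntegrable _ _)
          ((continuous_const.intervalIntegrable _ _).add hi)
          fun s _ => hq _
    _ = K + squareAverage g (fun s => s • t • v) / K := by
        rw [intervalIntegral.integral_add (continuous_const.intervalIntegrable _ _) hi,
          intervalIntegral.integral_div]
        simp [squareAverage]

lemma tendsto_integral_abs_sub_timeConstant (hd : 0 < d) (hP : TranslationInvariant P)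
    (hP_range : FiniteRangeDependence P) (hP_moment : FiniteExpMoment P)
    {v : EuclideanSpace ℝ (Fin d)} (hv : ‖v‖ = 1) :
    Tendsto (fun t : ℝ => ∫ g, |riemDist g 0 (t • v) / t - timeConstant P v| ∂P) atTop (𝓝 0) := by
  have h2 := hP_moment.integrable_sq hd
  set m := timeConstant P v with hm
  have hm0 : 0 ≤ m := timeConstant_nonneg P v
  set S := ∫ g, speedBound g 0 ^ 2 ∂P with hS
  have hS0 : 0 ≤ S := integral_nonneg fun g => sq_nonneg _
  set F : ℝ → RMetric d → ℝ := fun t g => |riemDist g 0 (t • v) / t - m| with hF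
  have hFm : ∀ t, Measurable (F t) := fun t =>
    (((measurable_riemDist 0 (t • v)).div_const t).sub_const m).abs
  have hFi : ∀ t, Integrable (F t) P := fun t =>
    (((integrable_riemDist hP h2 0 (t • v)).div_const t).sub (integrable_const m)).abs
  -- The truncated deviation tends to zero by dominated convergence; the excess over `K + m` is left
  -- to the second moment.
  have htrunc : ∀ K : ℝ, 0 < K →
      Tendsto (fun t => ∫ g, min (F t g) (K + m) ∂P) atTop (𝓝 0) := by
    intro K hK
    have := tendsto_integral_filter_of_dominated_convergence (μ := P) (l := atTop)
      (F := fun t g => min (F t g) (K + m)) (f := fun _ => (0 : ℝ)) (fun _ => K + m)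
      (Eventually.of_forall fun t => ((hFm t).min measurable_const).aestronglyMeasurable)
      (Eventually.of_forall fun t => Eventually.of_forall fun g => by
        rw [Real.norm_of_nonneg (le_min (abs_nonneg _) (by linarith))]
        exact min_le_right _ _)
      (integrable_const _) ?_
    · simpa using this
    · filter_upwards [ae_tendsto_riemDist_div hd hP hP_range hP_moment hv] with g hg
      have h3 : Tendsto (fun t => F t g) atTop (𝓝 0) := by
        have := (hg.sub_const m).abs
        simpa [hF, hm] using this
      refine squeeze_zero (fun t => le_min (abs_nonneg _) (by linarith))
        (fun t => min_le_left _ _) h3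
  refine tendsto_order.2 ⟨fun r hr => Eventually.of_forall fun t => hr.trans_le
    (integral_nonneg fun g => abs_nonneg _), fun r hr => ?_⟩
  -- This choice makes the excess `S / K` smaller than `r / 2`.
  set K : ℝ := 2 * (S + 1) / r with hKdef
  have hK : 0 < K := by positivity
  filter_upwards [(htrunc K hK).eventually (gt_mem_nhds (half_pos hr)), eventually_gt_atTop 0]
    with t ht ht0
  have hc : Continuous fun s : ℝ => s • t • v := by fun_prop
  obtain ⟨hQi, hQ⟩ := integrable_and_integral_squareAverage hP h2 hc
  have hmin : Integrable (fun g => min (F t g) (K + m)) P := (hFi t).inf (integrable_const _)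
  have hle : ∫ g, F t g ∂P
      ≤ ∫ g, (min (F t g) (K + m) + squareAverage g (fun s => s • t • v) / K) ∂P := by
    refine integral_mono (hFi t) (hmin.add (hQi.div_const K)) fun g => ?_
    have h3 := riemDist_div_le g hv ht0 hK
    have h4 : 0 ≤ riemDist g 0 (t • v) / t := div_nonneg (riemDist_nonneg _ _ _) ht0.le
    have h5 : 0 ≤ squareAverage g (fun s => s • t • v) / K :=
      div_nonneg (intervalIntegral.integral_nonneg zero_le_one fun _ _ => sq_nonneg _) hK.le
    have h6 : F t g ≤ K + m + squareAverage g (fun s => s • t • v) / K := by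
      simp only [hF]
      rw [abs_le]; constructor <;> linarith
    rcases le_total (F t g) (K + m) with h | h
    · simp only [min_eq_left h]; linarith
    · simp only [min_eq_right h]; linarith
  rw [integral_add hmin (hQi.div_const K), integral_div, hQ] at hle
  have h7 : S / K < r / 2 := by
    rw [hKdef, div_div_eq_mul_div, div_lt_iff₀ (by positivity)]
    nlinarith
  linarith

theorem isTimeConstant_timeConstant (hd : 0 < d) (hP : TranslationInvariant P)
    (hP_range : FiniteRangeDependence P) (hP_moment : FiniteExpMoment P)
    {v : EuclideanSpace ℝ (Fin d)} (hv : ‖v‖ = 1) : IsTimeConstant P v (timeConstant P v) :=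
  ⟨ae_tendsto_riemDist_div hd hP hP_range hP_moment hv,
    fun _ _ => integrable_riemDist hP (hP_moment.integrable_sq hd) _ _,
    tendsto_integral_abs_sub_timeConstant hd hP hP_range hP_moment hv⟩

lemma abs_riemDist_sub_le (g : RMetric d) (x y z : EuclideanSpace ℝ (Fin d)) :
    |riemDist g x y - riemDist g x z| ≤ riemDist g y z := by
  have h1 := riemDist_triangle g x y z
  have h2 := riemDist_triangle g x z y
  rw [riemDist_comm g z y] at h2
  rw [abs_le]; constructor <;> linarith

theorem ae_uniform_riemDist_div (hd : 0 < d) (hP : TranslationInvariant P)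
    (hP_range : FiniteRangeDependence P) (hP_moment : FiniteExpMoment P) {ε : ℝ} (hε : 0 < ε) :
    ∀ᵐ g ∂P, ∃ T : ℝ, 0 < T ∧ ∀ t : ℝ, T ≤ t →
      ∀ v : EuclideanSpace ℝ (Fin d), ‖v‖ = 1 →
        |riemDist g 0 (t • v) / t - timeConstant P v| ≤ ε := by
  obtain ⟨C, hC, hKB⟩ := exists_ae_riemDist_le hd hP hP_range hP_moment
  set δ : ℝ := ε / (3 * C) with hδ
  have hδ0 : 0 < δ := by positivity
  have hCδ : C * δ = ε / 3 := by rw [hδ]; field_simp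
  have close : ∀ g : RMetric d, ∀ t : ℝ, 0 < t →
      (∀ x y : EuclideanSpace ℝ (Fin d), ‖x‖ ≤ t → ‖y‖ ≤ t → ‖y - x‖ ≤ δ * t →
        riemDist g x y ≤ C * (δ * t)) →
      ∀ v w : EuclideanSpace ℝ (Fin d), ‖v‖ = 1 → ‖w‖ = 1 → dist v w ≤ δ →
        |riemDist g 0 (t • v) / t - riemDist g 0 (t • w) / t| ≤ ε / 3 := by
    intro g t ht hg v w hv hw hvw
    have h1 := (abs_riemDist_sub_le g 0 (t • v) (t • w)).trans (hg (t • v) (t • w)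
      (by rw [norm_smul, hv, mul_one, Real.norm_of_nonneg ht.le])
      (by rw [norm_smul, hw, mul_one, Real.norm_of_nonneg ht.le])
      (by
        rw [← smul_sub, norm_smul, Real.norm_of_nonneg ht.le, mul_comm, ← dist_eq_norm, dist_comm]
        exact mul_le_mul_of_nonneg_right hvw ht.le))
    rw [← sub_div, abs_div, abs_of_pos ht, div_le_iff₀ ht, ← hCδ, mul_assoc]
    exact h1
  -- The time constant inherits the modulus of continuity by passing to the limit at a single metric
  -- in the intersection of three almost sure events.
  have hμ : ∀ v w : EuclideanSpace ℝ (Fin d), ‖v‖ = 1 → ‖w‖ = 1 → dist v w ≤ δ →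
      |timeConstant P v - timeConstant P w| ≤ ε / 3 := by
    intro v w hv hw hvw
    obtain ⟨g, hgv, hgw, T, hT, hg⟩ := ((ae_tendsto_riemDist_div hd hP hP_range hP_moment hv).and
      ((ae_tendsto_riemDist_div hd hP hP_range hP_moment hw).and (hKB δ hδ0))).exists
    refine le_of_tendsto (hgv.sub hgw).abs ?_
    filter_upwards [eventually_ge_atTop T] with t ht
    exact close g t (hT.trans_le ht) (hg t ht) v w hv hw hvw
  -- A finite `δ`-net of the sphere: convergence is simultaneous on it, and each replacement of `v`
  -- by a net point costs `ε / 3`, once for the distance and once for the limit.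
  obtain ⟨F, hFsub, hFfin, hFcov⟩ := Metric.finite_approx_of_totallyBounded
    (isCompact_sphere (0 : EuclideanSpace ℝ (Fin d)) 1).totallyBounded δ hδ0
  have hF1 : ∀ w ∈ F, ‖w‖ = 1 := fun w hw => mem_sphere_zero_iff_norm.1 (hFsub hw)
  have hnet : ∀ᵐ g ∂P, ∀ w ∈ F, ∀ᶠ t : ℝ in atTop,
      |riemDist g 0 (t • w) / t - timeConstant P w| ≤ ε / 3 :=
    (ae_ball_iff hFfin.countable).2 fun w hw =>
      ae_eventually_abs_sub_timeConstant_le hd hP hP_range hP_moment (hF1 w hw) (by linarith)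
  filter_upwards [hnet, hKB δ hδ0] with g hg hgK
  obtain ⟨T, hT, hgK⟩ := hgK
  obtain ⟨T', hT'⟩ := eventually_atTop.1 ((Set.Finite.eventually_all hFfin).2 hg)
  refine ⟨max T T', hT.trans_le (le_max_left _ _), fun t ht v hv => ?_⟩
  have htT : T ≤ t := (le_max_left _ _).trans ht
  obtain ⟨w, hw, hvw⟩ := mem_iUnion₂.1 (hFcov (mem_sphere_zero_iff_norm.2 hv))
  have hvw' : dist v w ≤ δ := (Metric.mem_ball.1 hvw).le
  have h1 := abs_le.1 (close g t (hT.trans_le htT) (hgK t htT) v w hv (hF1 w hw) hvw')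
  have h2 := abs_le.1 (hμ v w hv (hF1 w hw) hvw')
  have h3 := abs_le.1 (hT' t ((le_max_right _ _).trans ht) w hw)
  rw [abs_le]
  constructor <;> linarith [h1.1, h1.2, h2.1, h2.2, h3.1, h3.2]

end Convergence

end RiemannianFPP

theorem mainTheorem5 (d : ℕ) (hd : 2 ≤ d)
    (P : MeasureTheory.Measure (RiemannianFPP.RMetric d)) [MeasureTheory.IsProbabilityMeasure P]
    (hP_inv : RiemannianFPP.TranslationInvariant P)
    (hP_range : RiemannianFPP.FiniteRangeDependence P)
    (hP_moment : RiemannianFPP.FiniteExpMoment P) :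
    ∃ μ : Metric.sphere (0 : EuclideanSpace ℝ (Fin d)) 1 → ℝ,
      (∀ v, 0 ≤ μ v ∧ RiemannianFPP.IsTimeConstant P v (μ v)) ∧
      ∀ ε : ℝ, 0 < ε → ∀ᵐ g ∂P, ∃ T : ℝ, 0 < T ∧ ∀ t : ℝ, T ≤ t →
        ∀ v : Metric.sphere (0 : EuclideanSpace ℝ (Fin d)) 1,
          |1 / t * RiemannianFPP.riemDist g 0 (t • (v : EuclideanSpace ℝ (Fin d))) - μ v| ≤ ε := by
  have hd0 : 0 < d := by omega
  have hnorm : ∀ v : Metric.sphere (0 : EuclideanSpace ℝ (Fin d)) 1,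
      ‖(v : EuclideanSpace ℝ (Fin d))‖ = 1 := fun v => mem_sphere_zero_iff_norm.1 v.2
  refine ⟨fun v => RiemannianFPP.timeConstant P v, fun v =>
    ⟨RiemannianFPP.timeConstant_nonneg P v, RiemannianFPP.isTimeConstant_timeConstant hd0 hP_inv
      hP_range hP_moment (hnorm v)⟩, fun ε hε => ?_⟩
  filter_upwards [RiemannianFPP.ae_uniform_riemDist_div hd0 hP_inv hP_range hP_moment hε]
    with g ⟨T, hT, hg⟩
  refine ⟨T, hT, fun t ht v => ?_⟩
  rw [one_div, inv_mul_eq_div]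
  exact hg t ht v (hnorm v)
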